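/- Let $d\ge 2$ and let $\mu_1,\dots,\mu_d$ be Borel probability measures on $\mathbb R^d$. Let $\Pi(\mu_1,\dots,\mu_d)$ be the set of Borel probability measures on $(\mathbb R^d)^d$ whose marginals are $\mu_1,\dots,\mu_d$, and let (MK) be the problem $$\sup_{\gamma\in\Pi(\mu_1,\dots,\mu_d)}\int_{(\mathbb R^d)^d}\det(x_1,\dots,x_d)\,d\gamma(x_1,\dots,x_d).$$ Assume that every $\mu_i$ is radially symmetric ($R_\sharp\mu_i=\mu_i$ for every $R$ in the orthogonal group of $\mathbb R^d$) and that every radial law $\mu_i^r=|\cdot|_\sharp\mu_i$ on $\mathbb R_+$ has no atom. For $2\le i\le d$ let $H_i$ be the monotone rearrangement of $\mu_1^r$ into $\mu_i^r$, that is, the Borel map with $H_{i\sharp}\mu_1^r=\mu_i^r$ that is nondecreasing on a set of full $\mu_1^r$-measure; such a map exists and is unique up to $\mu_1^r$-null sets. For vectors $y_1,\dots,y_{d-1}$ of $\mathbb R^d$, let $y_1\wedge\dots\wedge y_{d-1}$ be the vector with $\det(y_1,\dots,y_{d-1},v)=\langle v,\,y_1\wedge\dots\wedge y_{d-1}\rangle$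 for all $v\in\mathbb R^d$. Let $\bar\gamma$ be the law of $(x_1,\dots,x_d)$ when $x_1$ has law $\mu_1$; for $2\le i\le d-1$, given $x_1,\dots,x_{i-1}$, the vector $x_i$ is uniformly distributed (with respect to the normalized $(d-i)$-dimensional Hausdorff measure) on $H_i(|x_1|)\,S(x_1,\dots,x_{i-1})$, where $S(x_1,\dots,x_{i-1})$ is the unit sphere of $\{x_1,\dots,x_{i-1}\}^\perp$; and $$x_d=H_d(|x_1|)\,\frac{x_1}{|x_1|}\wedge\dots\wedge\frac{x_{d-1}}{|x_{d-1}|}.$$ Then $\bar\gamma\in\Pi(\mu_1,\dots,\mu_d)$ and $\bar\gamma$ is a solution of (MK), where the integral of $\det$ is read in the extended sense $\int\det^+d\gamma-\int\det^-d\gamma$ with $\infty-\infty=-\infty$. If moreover there are $p_1,\dots,p_d\in(1,\infty)$ with $\sum_i 1/p_i=1$ and $\int|x|^{p_i}\,d\mu_i<\infty$ for every $i$, then $\det$ is $\gamma$-integrable for every $\gamma\in\Pi(\mu_1,\dots,\mu_d)$, so that $\bar\gamma$ solves (MK) with ordinary finite integrals. Finally, for $\bar\gamma$-almost every $(x_1,\dots,x_d)$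 the vectors form a direct orthogonal basis of $\mathbb R^d$ (pairwise orthogonal with positive determinant), and $|x_i|=H_i(|x_1|)$ for $2\le i\le d$. -/

import Mathlib

open scoped Pointwise MeasureTheory
open MeasureTheory

noncomputable section

namespace DetTransport

/-- The Euclidean space `ℝ^d`. -/
abbrev E (d : ℕ) : Type := EuclideanSpace ℝ (Fin d)

/-- The determinant `det (x_1, …, x_d)` of `d` vectors of `ℝ^d`. -/
def vdet {d : ℕ} (x : Fin d → E d) : ℝ := Matrix.det (Matrix.of fun i j => x i j)

/-- The wedge product `y_1 ∧ … ∧ y_n` of `n` vectors of `ℝ^(n+1)`: its coordinates are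
`det (y_1, …, y_n, e_j)`. -/
def wedge {n : ℕ} (y : Fin n → E (n + 1)) : E (n + 1) :=
  WithLp.toLp 2 fun j => vdet (Fin.snoc y (EuclideanSpace.single j (1 : ℝ)) : Fin (n + 1) → E (n + 1))

/-- The wedge product is characterized by `det (y_1, …, y_n, v) = ⟨v, y_1 ∧ … ∧ y_n⟩`. -/
theorem vdet_snoc_eq_inner_wedge {n : ℕ} (y : Fin n → E (n + 1)) (v : E (n + 1)) :
    vdet (Fin.snoc y v : Fin (n + 1) → E (n + 1)) = inner ℝ v (wedge y) := by
  have key : ∀ w : E (n + 1), vdet (Fin.snoc y w : Fin (n + 1) → E (n + 1)) =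
      ((Matrix.of fun i j => (Fin.snoc y 0 : Fin (n + 1) → E (n + 1)) i j).updateRow
        (Fin.last n) w).det := by
    intro w
    unfold vdet
    congr 1
    ext i j
    refine Fin.lastCases ?_ (fun i => ?_) i
    · simp
    · rw [Matrix.updateRow_ne (Fin.castSucc_lt_last i).ne]
      simp
  set M := (Matrix.of fun i j => (Fin.snoc y 0 : Fin (n + 1) → E (n + 1)) i j) with hM
  have hv : (v : Fin (n + 1) → ℝ) =
      ∑ j, v j • ((EuclideanSpace.single j (1 : ℝ) : E (n + 1)) : Fin (n + 1) → ℝ) := by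
    ext k
    simp [Finset.sum_apply, Pi.single_apply]
  rw [key v]
  have hlin : ∀ w : Fin (n + 1) → ℝ, (M.updateRow (Fin.last n) w).det =
      ((Matrix.detRowAlternating (R := ℝ) (n := Fin (n + 1))).toMultilinearMap.toLinearMap
        M (Fin.last n)) w := fun w => rfl
  rw [hlin, hv, map_sum]
  have hs : ∀ (c : ℝ) (w : Fin (n + 1) → ℝ), (M.updateRow (Fin.last n) (c • w)).det =
      c * (M.updateRow (Fin.last n) w).det := fun c w => Matrix.det_updateRow_smul M _ c w
  simp only [← hlin, hs, ← key]
  simp [wedge, PiLp.inner_apply, mul_comm]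

/-- The set `Π(μ_1, …, μ_d)` of probability measures on `(ℝ^d)^d` with marginals `μ_i`. -/
def plans {d : ℕ} (μ : Fin d → Measure (E d)) : Set (Measure (Fin d → E d)) :=
  {γ | IsProbabilityMeasure γ ∧ ∀ i, γ.map (fun x => x i) = μ i}

/-- The objective `∫ det dγ` as an extended real number, the integral of the positive part
minus the integral of the negative part, where `∞ - ∞` is read as `-∞`. -/
def detIntegral {d : ℕ} (γ : Measure (Fin d → E d)) : EReal :=
  ((∫⁻ x, ENNReal.ofReal (vdet x) ∂γ : ENNReal) : EReal)
    - ((∫⁻ x, ENNReal.ofReal (-vdet x) ∂γ : ENNReal) : EReal)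

/-- There are exponents `p_i ∈ (1, ∞)` with `∑ 1 / p_i = 1` such that each `μ_i` has a finite
moment of order `p_i`. -/
def MomentCondition {d : ℕ} (μ : Fin d → Measure (E d)) : Prop :=
  ∃ p : Fin d → ℝ, (∀ i, 1 < p i) ∧ ∑ i, 1 / p i = 1 ∧
    ∀ i, Integrable (fun x => ‖x‖ ^ p i) (μ i)

/-- Invariance under the orthogonal group. -/
def RadiallySymmetric {d : ℕ} (μ : Measure (E d)) : Prop :=
  ∀ R : E d ≃ₗᵢ[ℝ] E d, μ.map R = μ

/-- The law of `|x|` under `μ`. -/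
def radialLaw {d : ℕ} (μ : Measure (E d)) : Measure ℝ := μ.map fun x => ‖x‖

/-- `h` is a Borel map pushing `ρ` forward to `ν` and nondecreasing on a set of full measure.
(One cannot ask for monotonicity on a half-line: if `ρ` has bounded and `ν` has unbounded
support, then `h` is unbounded near the end of the support of `ρ`.) -/
def IsMonotoneRearrangement (ρ ν : Measure ℝ) (h : ℝ → ℝ) : Prop :=
  Measurable h ∧ ρ.map h = ν ∧ ∃ S : Set ℝ, ρ Sᶜ = 0 ∧ MonotoneOn h S

/-- The unit sphere of the orthogonal complement of `x_1, …, x_k`. -/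
def orthSphere {d k : ℕ} (x : Fin k → E d) : Set (E d) :=
  {y | ‖y‖ = 1 ∧ ∀ i, inner ℝ (x i) y = 0}

/-- The uniform law on the sphere of radius `r` orthogonal to `x_1, …, x_k`: the normalized
restriction to it of the Hausdorff measure of dimension `d - k - 1`. -/
def uniformOrthSphere {d k : ℕ} (x : Fin k → E d) (r : ℝ) : Measure (E d) :=
  ProbabilityTheory.cond μH[(d : ℝ) - k - 1] (r • orthSphere x)

/-- The joint law of `(x_1, …, x_{k+1})` when `x_1` has law `μ₁` and, given `x_1, …, x_i`, the
vector `x_{i+1}` is uniform on the sphere of radius `H i |x_1|` orthogonal to `x_1, …, x_i`.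
Here `H i` with `i ≥ 1` is the map for the vector of zero-based index `i`. -/
def sphericalLaw {d : ℕ} (μ₁ : Measure (E d)) (H : ℕ → ℝ → ℝ) :
    (k : ℕ) → Measure (Fin (k + 1) → E d)
  | 0 => μ₁.map fun x _ => x
  | k + 1 => (sphericalLaw μ₁ H k).bind fun x =>
      (uniformOrthSphere x (H (k + 1) ‖x 0‖)).map fun y => Fin.snoc x y

/-- The explicit plan in dimension `d = n + 2`: the vectors `x_1, …, x_{d-1}` are drawn
according to `sphericalLaw`, and `x_d` is `H_d(|x_1|)` times the wedge product of the
normalized vectors `x_i / |x_i|`, `1 ≤ i ≤ d - 1`. -/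
def radialPlan {n : ℕ} (μ₁ : Measure (E (n + 2))) (H : ℕ → ℝ → ℝ) :
    Measure (Fin (n + 2) → E (n + 2)) :=
  (sphericalLaw μ₁ H n).bind fun x =>
    Measure.dirac (Fin.snoc x (H (n + 1) ‖x 0‖ • wedge fun i => ‖x i‖⁻¹ • x i))

/-- `(x_1, …, x_d)` is a direct orthogonal basis of `ℝ^d`: the vectors are pairwise orthogonal
and their determinant is positive (in particular nonzero, so they form a basis). -/
def IsDirectOrthogonalBasis {d : ℕ} (x : Fin d → E d) : Prop :=
  (∀ i j, i ≠ j → inner ℝ (x i) (x j) = 0) ∧ 0 < vdet x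

end DetTransport

end

/-! Hadamard's inequality bounds `det (x_1, …, x_d)` by `∏ |x_i|`, with equality exactly when the
vectors are orthogonal with nonnegative determinant (apart from the trivial case of a zero vector).
The integral of `∏ |x_i|` involves only the joint law of the norms. By the layer cake formula it is
largest when all the norms are nondecreasing functions of one variable, here `|x_1|`. The explicit
plan reaches both bounds at once: its vectors form direct orthogonal bases and `|x_i| = H_i(|x_1|)`.
This is `lintegral_vdet_le`, which rests on `abs_vdet_le` and `lintegral_prod_le_of_monotoneOn`.
Since the determinant is positive almost surely under the plan, its negative part contributes
nothing, and comparing positive parts is enough.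

The longer task is admissibility, `radialPlan_mem_plans`. Each marginal of the plan has the right
radial law, and it is invariant under rotations because every step of the construction commutes with
them. A law with these symmetries is determined by its radial law (`measure_eq_of_radialLaw_eq`).
For the construction to define probability measures, the spheres must have positive finite Hausdorff
measure, and the uniform laws must depend measurably on the previous vectors. The latter holds
because they are images of one fixed law under `frameIsometry`, a measurable choice of isometry. -/

noncomputable section

namespace DetTransport

/-! ### Monotone rearrangement on the line -/

section Rearrangement

/-- Two measurable nondecreasing maps (on full sets) with the same push-forward agree a.e. -/
theorem IsMonotoneRearrangement.ae_eq {ρ ν : Measure ℝ} [IsFiniteMeasure ρ] {h h' : ℝ → ℝ}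
    (hh : IsMonotoneRearrangement ρ ν h) (hh' : IsMonotoneRearrangement ρ ν h') : h' =ᵐ[ρ] h := by
  obtain ⟨hm, hp, S, hS, hmono⟩ := hh
  obtain ⟨hm', hp', S', hS', hmono'⟩ := hh'
  have hmeas : ∀ a, ρ (h ⁻¹' Set.Iic a) = ρ (h' ⁻¹' Set.Iic a) := fun a => by
    rw [← Measure.map_apply hm measurableSet_Iic, ← Measure.map_apply hm' measurableSet_Iic, hp, hp']
  have hT : ∀ᵐ t ∂ρ, t ∈ S ∩ S' := by
    have h1 : ∀ᵐ t ∂ρ, t ∈ S := hS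
    have h2 : ∀ᵐ t ∂ρ, t ∈ S' := hS'
    filter_upwards [h1, h2] with t a b using ⟨a, b⟩
  -- On `S ∩ S'` both sublevel sets are initial segments, hence nested. They have the same finite
  -- measure, so they agree up to a null set. Rational levels then suffice.
  have key : ∀ a, ∀ᵐ t ∂ρ, (h t ≤ a ↔ h' t ≤ a) := by
    intro a
    have haux : (∀ᵐ t ∂ρ, h t ≤ a → h' t ≤ a) ∨ (∀ᵐ t ∂ρ, h' t ≤ a → h t ≤ a) := by
      by_contra hcon
      rw [not_or, Filter.not_eventually, Filter.not_eventually] at hcon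
      obtain ⟨t, ht, htS⟩ := (hcon.1.and_eventually hT).exists
      obtain ⟨s, hs, hsS⟩ := (hcon.2.and_eventually hT).exists
      push Not at ht hs
      rcases le_total s t with hst | hst
      · exact absurd ((hmono hsS.1 htS.1 hst).trans ht.1) (not_le.2 hs.2)
      · exact absurd ((hmono' htS.2 hsS.2 hst).trans hs.1) (not_le.2 ht.2)
    have heq : h ⁻¹' Set.Iic a =ᵐ[ρ] h' ⁻¹' Set.Iic a := by
      rcases haux with h1 | h1
      · exact ae_eq_of_ae_subset_of_measure_ge h1 (hmeas a).ge
          (hm measurableSet_Iic).nullMeasurableSet (measure_ne_top _ _)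
      · exact (ae_eq_of_ae_subset_of_measure_ge h1 (hmeas a).le
          (hm' measurableSet_Iic).nullMeasurableSet (measure_ne_top _ _)).symm
    filter_upwards [heq] with t ht
    exact iff_of_eq ht
  have key' : ∀ᵐ t ∂ρ, ∀ q : ℚ, (h t ≤ q ↔ h' t ≤ q) := ae_all_iff.2 fun q => key q
  filter_upwards [key'] with t ht
  refine le_antisymm (le_of_forall_gt_imp_ge_of_dense fun a ha => ?_)
    (le_of_forall_gt_imp_ge_of_dense fun a ha => ?_)
  · obtain ⟨q, hq, hqa⟩ := exists_rat_btwn ha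
    exact ((ht q).1 hq.le).trans hqa.le
  · obtain ⟨q, hq, hqa⟩ := exists_rat_btwn ha
    exact ((ht q).2 hq.le).trans hqa.le

open ProbabilityTheory Filter Topology

theorem continuous_cdf_of_noAtoms (ρ : Measure ℝ) [IsProbabilityMeasure ρ] (hρ : ∀ r, ρ {r} = 0) :
    Continuous (cdf ρ) := by
  rw [continuous_iff_continuousAt]
  intro x
  have h1 : ρ {x} = ENNReal.ofReal (cdf ρ x - Function.leftLim (cdf ρ) x) := by
    conv_lhs => rw [← measure_cdf ρ]
    exact StieltjesFunction.measure_singleton _ x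
  rw [hρ, eq_comm, ENNReal.ofReal_eq_zero, sub_nonpos] at h1
  rw [(monotone_cdf ρ).continuousAt_iff_leftLim_eq_rightLim, StieltjesFunction.rightLim_eq]
  exact le_antisymm ((monotone_cdf ρ).leftLim_le le_rfl) h1

/-- The distribution function of an atomless law is uniformly distributed. -/
theorem measure_cdf_le_of_mem_Ioo {ρ : Measure ℝ} [IsProbabilityMeasure ρ] (hρ : ∀ r, ρ {r} = 0)
    {p : ℝ} (hp : p ∈ Set.Ioo (0 : ℝ) 1) : ρ {t | cdf ρ t ≤ p} = ENNReal.ofReal p := by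
  have hc := continuous_cdf_of_noAtoms ρ hρ
  obtain ⟨a, ha⟩ := ((tendsto_cdf_atBot ρ).eventually_lt_const hp.1).exists
  obtain ⟨c, hcc⟩ := ((tendsto_cdf_atTop ρ).eventually_const_lt hp.2).exists
  obtain ⟨b, hb⟩ : p ∈ Set.range (cdf ρ) := mem_range_of_exists_le_of_exists_ge hc ⟨a, ha.le⟩ ⟨c, hcc.le⟩
  -- By continuity and monotonicity this is a closed half-line ending at the last point where the
  -- distribution function equals `p`.
  set A := {t | cdf ρ t ≤ p}
  have hAc : IsClosed A := isClosed_le hc continuous_const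
  have hAb : BddAbove A := ⟨c, fun t ht => by
    by_contra h
    exact absurd (hcc.trans_le (monotone_cdf ρ (not_le.1 h).le)) (not_lt.2 ht)⟩
  have hAn : A.Nonempty := ⟨b, hb.le⟩
  have hs : sSup A ∈ A := hAc.csSup_mem hAn hAb
  have hA : A = Set.Iic (sSup A) := by
    ext t
    exact ⟨fun ht => le_csSup hAb ht, fun ht => (monotone_cdf ρ ht).trans hs⟩
  rw [hA, ← ofReal_cdf]
  congr 1
  exact le_antisymm hs (hb.symm.le.trans (monotone_cdf ρ (le_csSup hAb hb.le)))

theorem measure_cdf_le {ρ : Measure ℝ} [IsProbabilityMeasure ρ] (hρ : ∀ r, ρ {r} = 0)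
    {p : ℝ} (h0 : 0 ≤ p) (h1 : p ≤ 1) : ρ {t | cdf ρ t ≤ p} = ENNReal.ofReal p := by
  rcases h0.eq_or_lt with rfl | h0
  · rw [ENNReal.ofReal_zero]
    refine le_antisymm (ENNReal.le_of_forall_pos_le_add fun ε hε _ => ?_) bot_le
    have hq : min (ε : ℝ) (1 / 2) ∈ Set.Ioo (0 : ℝ) 1 := ⟨lt_min hε (by norm_num), by
      exact (min_le_right _ _).trans_lt (by norm_num)⟩
    calc ρ {t | cdf ρ t ≤ 0} ≤ ρ {t | cdf ρ t ≤ min (ε : ℝ) (1 / 2)} :=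
          measure_mono fun t ht => le_trans ht hq.1.le
      _ = ENNReal.ofReal (min (ε : ℝ) (1 / 2)) := measure_cdf_le_of_mem_Ioo hρ hq
      _ ≤ ENNReal.ofReal (ε : ℝ) := ENNReal.ofReal_le_ofReal (min_le_left _ _)
      _ = 0 + ε := by rw [ENNReal.ofReal_coe_nnreal, zero_add]
  · rcases h1.eq_or_lt with rfl | h1
    · rw [ENNReal.ofReal_one, show {t | cdf ρ t ≤ 1} = Set.univ from
        Set.eq_univ_of_forall fun t => cdf_le_one ρ t, measure_univ]
    · exact measure_cdf_le_of_mem_Ioo hρ ⟨h0, h1⟩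

theorem ae_cdf_mem_Ioo {ρ : Measure ℝ} [IsProbabilityMeasure ρ] (hρ : ∀ r, ρ {r} = 0) :
    ∀ᵐ t ∂ρ, cdf ρ t ∈ Set.Ioo (0 : ℝ) 1 := by
  have h0 : ∀ᵐ t ∂ρ, 0 < cdf ρ t := by
    have : ρ {t | cdf ρ t ≤ 0} = 0 := by simpa using measure_cdf_le hρ le_rfl zero_le_one
    rw [ae_iff]
    simpa using this
  have h1 : ∀ᵐ t ∂ρ, cdf ρ t < 1 := by
    have hms : MeasurableSet {t | cdf ρ t < 1} :=
      (monotone_cdf ρ).measurable measurableSet_Iio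
    -- The set contains `{cdf ρ ≤ p}`, of mass `p`, for every `p < 1`.
    have hle : 1 ≤ ρ {t | cdf ρ t < 1} := by
      refine le_of_forall_lt fun c hc => ?_
      obtain ⟨p, hp0, hcp, hp1⟩ := ENNReal.lt_iff_exists_real_btwn.1 hc
      have hp1' : p < 1 := by simpa using hp1
      refine hcp.trans_le ?_
      rw [← measure_cdf_le hρ hp0 hp1'.le]
      exact measure_mono fun t ht => lt_of_le_of_lt ht hp1'
    exact (prob_compl_eq_zero_iff hms).2 (le_antisymm prob_le_one hle)
  filter_upwards [h0, h1] with t a b using ⟨a, b⟩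

/-- Existence of the monotone rearrangement of an atomless law into an arbitrary one. -/
theorem exists_isMonotoneRearrangement (ρ ν : Measure ℝ) [IsProbabilityMeasure ρ]
    [IsProbabilityMeasure ν] (hρ : ∀ r, ρ {r} = 0) : ∃ h, IsMonotoneRearrangement ρ ν h := by
  classical
  set S : Set ℝ := cdf ρ ⁻¹' Set.Ioo (0 : ℝ) 1 with hS
  have hSm : MeasurableSet S := (monotone_cdf ρ).measurable measurableSet_Ioo
  have hSae : ∀ᵐ t ∂ρ, t ∈ S := ae_cdf_mem_Ioo hρ
  -- The quantile function of `ν` composed with the distribution function of `ρ`. Off the null set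
  -- `Sᶜ` the infimum may be over an empty or unbounded set, so a constant is used there.
  set h : ℝ → ℝ := fun t => if t ∈ S then sInf {x | cdf ρ t ≤ cdf ν x} else 0 with hh
  have hbdd : ∀ t ∈ S, BddBelow {x | cdf ρ t ≤ cdf ν x} := by
    intro t ht
    obtain ⟨a, ha⟩ := ((tendsto_cdf_atBot ν).eventually_lt_const ht.1).exists
    exact ⟨a, fun x hx => by
      by_contra hxa
      exact absurd (hx.trans (monotone_cdf ν (not_le.1 hxa).le)) (not_le.2 ha)⟩
  have hne : ∀ t ∈ S, {x | cdf ρ t ≤ cdf ν x}.Nonempty := by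
    intro t ht
    obtain ⟨a, ha⟩ := ((tendsto_cdf_atTop ν).eventually_const_lt ht.2).exists
    exact ⟨a, ha.le⟩
  -- Right continuity of `cdf ν` makes the infimum attained. Measurability, monotonicity and the
  -- push-forward all follow from this equivalence.
  have hgal : ∀ t ∈ S, ∀ x, h t ≤ x ↔ cdf ρ t ≤ cdf ν x := by
    intro t ht x
    simp only [hh, if_pos ht]
    refine ⟨fun hx => ?_, fun hx => csInf_le (hbdd t ht) hx⟩
    have hlim : Tendsto (cdf ν) (𝓝[>] x) (𝓝 (cdf ν x)) :=
      ((cdf ν).right_continuous x).tendsto.mono_left (nhdsWithin_mono _ Set.Ioi_subset_Ici_self)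
    refine ge_of_tendsto hlim ?_
    filter_upwards [self_mem_nhdsWithin] with y hy
    obtain ⟨z, hz, hzy⟩ := exists_lt_of_csInf_lt (hne t ht) (hx.trans_lt hy)
    exact hz.trans (monotone_cdf ν hzy.le)
  have hpre : ∀ x, h ⁻¹' Set.Iic x ∩ S = {t | cdf ρ t ≤ cdf ν x} ∩ S := by
    intro x
    ext t
    refine and_congr_left fun ht => hgal t ht x
  have hm : Measurable h := by
    refine measurable_of_Iic fun x => ?_
    have : h ⁻¹' Set.Iic x = ({t | cdf ρ t ≤ cdf ν x} ∩ S) ∪ ({t | (0 : ℝ) ≤ x} ∩ Sᶜ) := by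
      rw [← hpre x, ← Set.inter_union_compl (h ⁻¹' Set.Iic x) S]
      congr 1
      · rw [Set.inter_union_compl]
      · ext t
        refine and_congr_left fun ht => ?_
        have ht' : t ∉ S := ht
        simp [hh, ht']
    rw [this]
    exact (((monotone_cdf ρ).measurable measurableSet_Iic).inter hSm).union
      ((MeasurableSet.const _).inter hSm.compl)
  refine ⟨h, hm, ?_, S, hSae, ?_⟩
  · have : IsProbabilityMeasure (ρ.map h) := Measure.isProbabilityMeasure_map hm.aemeasurable
    refine Measure.ext_of_Iic _ _ fun x => ?_
    rw [Measure.map_apply hm measurableSet_Iic, ← ofReal_cdf ν x,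
      ← measure_cdf_le hρ (cdf_nonneg ν x) (cdf_le_one ν x)]
    refine measure_congr ?_
    filter_upwards [hSae] with t ht
    exact propext (hgal t ht x)
  · intro s hs t ht hst
    rw [hgal s hs]
    exact (monotone_cdf ρ hst).trans ((hgal t ht _).1 le_rfl)

end Rearrangement

/-! ### Comonotone maximization of the integral of a product -/

section ProductInequality

open scoped ENNReal

/-- Layer cake formula for the integral of a product of nonnegative functions. -/
theorem lintegral_prod_eq_lintegral_measure {α ι : Type*} [Fintype ι] [MeasurableSpace α]
    (γ : Measure α) [SFinite γ] (X : ι → α → ℝ) (hX : ∀ i, Measurable (X i)) :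
    ∫⁻ a, ∏ i, ENNReal.ofReal (X i a) ∂γ =
      ∫⁻ t : ι → ℝ, γ {a | ∀ i, 0 ≤ t i ∧ t i < X i a} := by
  have hms : MeasurableSet {q : α × (ι → ℝ) | ∀ i, 0 ≤ q.2 i ∧ q.2 i < X i q.1} := by
    have : {q : α × (ι → ℝ) | ∀ i, 0 ≤ q.2 i ∧ q.2 i < X i q.1} =
        ⋂ i, ({q | 0 ≤ q.2 i} ∩ {q | q.2 i < X i q.1}) := by
      ext q; simp
    rw [this]
    refine MeasurableSet.iInter fun i => ?_
    have h2 : Measurable fun q : α × (ι → ℝ) => q.2 i := (measurable_pi_apply i).comp measurable_snd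
    exact (measurableSet_le measurable_const h2).inter
      (measurableSet_lt h2 ((hX i).comp measurable_fst))
  -- Tonelli for the region under the graphs: its slice at `a` is a box whose volume is the product.
  have h1 := Measure.prod_apply (μ := γ) (ν := (volume : Measure (ι → ℝ))) hms
  have h2 := Measure.prod_apply_symm (μ := γ) (ν := (volume : Measure (ι → ℝ))) hms
  rw [h1] at h2
  rw [show (∫⁻ t : ι → ℝ, γ {a | ∀ i, 0 ≤ t i ∧ t i < X i a}) = _ from h2.symm]
  refine lintegral_congr fun a => ?_
  have := Real.volume_pi_Ico (a := fun _ : ι => (0 : ℝ)) (b := fun i => X i a)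
  simp only [sub_zero] at this
  rw [← this]
  congr 1
  ext t
  simp

/-- A product of nonnegative functions has the largest integral when the functions are
nondecreasing functions of a common variable. -/
theorem lintegral_prod_le_of_monotoneOn {α ι : Type*} [Fintype ι] [Nonempty ι] [MeasurableSpace α]
    (γ : Measure α) [SFinite γ] (X : ι → α → ℝ) (hX : ∀ i, Measurable (X i))
    (ρ : Measure ℝ) [SFinite ρ] (Y : ι → ℝ → ℝ) (hY : ∀ i, Measurable (Y i))
    (hmap : ∀ i, γ.map (X i) = ρ.map (Y i)) (T : Set ℝ) (hT : ∀ᵐ t ∂ρ, t ∈ T)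
    (hmono : ∀ i, MonotoneOn (Y i) T) :
    ∫⁻ a, ∏ i, ENNReal.ofReal (X i a) ∂γ ≤ ∫⁻ r, ∏ i, ENNReal.ofReal (Y i r) ∂ρ := by
  rw [lintegral_prod_eq_lintegral_measure γ X hX, lintegral_prod_eq_lintegral_measure ρ Y hY]
  refine lintegral_mono fun t => ?_
  by_cases ht : ∀ i, 0 ≤ t i
  swap
  · rw [not_forall] at ht
    obtain ⟨i, hi⟩ := ht
    have : {a | ∀ i, 0 ≤ t i ∧ t i < X i a} = ∅ := by
      ext a; simp only [Set.mem_ofPred_eq, Set.mem_empty_iff_false, iff_false]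
      exact fun h => hi (h i).1
    simp [this]
  -- These are final segments of `T`, hence a chain. Their intersection is the smallest of them, so
  -- under `ρ` the joint event has the probability of its rarest condition, an upper bound for any
  -- coupling.
  set A : ι → Set ℝ := fun i => {r ∈ T | t i < Y i r}
  have htot : ∀ i j, A i ⊆ A j ∨ A j ⊆ A i := by
    intro i j
    by_contra hcon
    rw [not_or, Set.not_subset, Set.not_subset] at hcon
    obtain ⟨⟨r, hr, hr'⟩, ⟨s, hs, hs'⟩⟩ := hcon
    rcases le_total r s with hrs | hrs
    · exact hs' ⟨hs.1, hr.2.trans_le (hmono i hr.1 hs.1 hrs)⟩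
    · exact hr' ⟨hr.1, hs.2.trans_le (hmono j hs.1 hr.1 hrs)⟩
  obtain ⟨i, -, hi⟩ := Finset.exists_minimalFor A Finset.univ Finset.univ_nonempty
  have hi' : ∀ j, A i ⊆ A j := fun j => (htot i j).elim id fun h => hi (Finset.mem_univ j) h
  calc γ {a | ∀ i, 0 ≤ t i ∧ t i < X i a} ≤ γ (X i ⁻¹' Set.Ioi (t i)) :=
        measure_mono fun a ha => (ha i).2
    _ = ρ (Y i ⁻¹' Set.Ioi (t i)) := by
        rw [← Measure.map_apply (hX i) measurableSet_Ioi, hmap,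
          Measure.map_apply (hY i) measurableSet_Ioi]
    _ ≤ ρ {r | ∀ i, 0 ≤ t i ∧ t i < Y i r} := by
        refine measure_mono_ae ?_
        filter_upwards [hT] with r hr hri j
        exact ⟨ht j, (hi' j ⟨hr, hri⟩).2⟩

end ProductInequality

/-! ### Hadamard's inequality and reflections -/

section Determinant

instance fact_finrank_E (d : ℕ) : Fact (Module.finrank ℝ (E d) = d) := ⟨by simp⟩

/-- Gives access to Hadamard's inequality, its equality case, and invariance under rotations. -/
theorem vdet_eq_volumeForm {d : ℕ} (x : Fin d → E d) :
    vdet x = (EuclideanSpace.basisFun (Fin d) ℝ).toBasis.orientation.volumeForm x := by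
  rw [Orientation.volumeForm_robust _ (EuclideanSpace.basisFun (Fin d) ℝ) rfl,
    Module.Basis.det_apply, vdet, ← Matrix.det_transpose]
  rfl

theorem abs_vdet_le {d : ℕ} (x : Fin d → E d) : |vdet x| ≤ ∏ i, ‖x i‖ := by
  rw [vdet_eq_volumeForm]
  exact Orientation.abs_volumeForm_apply_le _ x

theorem abs_vdet_of_pairwise_orthogonal {d : ℕ} {x : Fin d → E d}
    (hx : ∀ i j, i ≠ j → inner ℝ (x i) (x j) = 0) : |vdet x| = ∏ i, ‖x i‖ := by
  rw [vdet_eq_volumeForm]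
  exact Orientation.abs_volumeForm_apply_of_pairwise_orthogonal _ fun i j h => hx i j h

theorem vdet_smul {d : ℕ} (c : Fin d → ℝ) (x : Fin d → E d) :
    vdet (fun i => c i • x i) = (∏ i, c i) * vdet x := by
  simp only [vdet_eq_volumeForm]
  exact AlternatingMap.map_smul_univ _ c x

theorem vdet_comp_linearIsometryEquiv {d : ℕ} (R : E d ≃ₗᵢ[ℝ] E d)
    (hR : 0 < LinearMap.det (R.toLinearEquiv : E d →ₗ[ℝ] E d)) (x : Fin d → E d) :
    vdet (fun i => R (x i)) = vdet x := by
  simp only [vdet_eq_volumeForm]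
  exact Orientation.volumeForm_comp_linearIsometryEquiv _ R hR x

theorem vdet_eq_zero_of_eq {d : ℕ} {x : Fin d → E d} {i j : Fin d} (hij : i ≠ j)
    (h : x i = x j) : vdet x = 0 := by
  rw [vdet_eq_volumeForm]
  exact AlternatingMap.map_eq_zero_of_eq _ x h hij

theorem measurable_vdet {d : ℕ} : Measurable (vdet : (Fin d → E d) → ℝ) := by
  unfold vdet
  simp only [Matrix.det_apply]
  fun_prop

/-- The reflection across the hyperplane orthogonal to a vector. -/
def hyperplaneReflection {d : ℕ} (v : E d) : E d ≃ₗᵢ[ℝ] E d := (ℝ ∙ v)ᗮ.reflection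

/-- Makes measurability in `v` visible. At `v = 0` the formula correctly gives the identity. -/
theorem hyperplaneReflection_apply {d : ℕ} (v y : E d) :
    hyperplaneReflection v y = y - (2 * (inner ℝ v y / ‖v‖ ^ 2)) • v := by
  rw [hyperplaneReflection, Submodule.reflection_orthogonal_apply,
    Submodule.reflection_singleton_apply]
  simp [two_smul, two_mul, add_smul]

theorem hyperplaneReflection_of_inner_eq_zero {d : ℕ} {v y : E d} (h : inner ℝ v y = 0) :
    hyperplaneReflection v y = y := by
  simp [hyperplaneReflection_apply, h]

theorem hyperplaneReflection_sub {d : ℕ} {v w : E d} (h : ‖v‖ = ‖w‖) :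
    hyperplaneReflection (v - w) v = w := Submodule.reflection_sub h

theorem det_hyperplaneReflection {d : ℕ} {v : E d} (hv : v ≠ 0) :
    LinearMap.det ((hyperplaneReflection v).toLinearEquiv : E d →ₗ[ℝ] E d) = -1 := by
  have := Submodule.det_reflection (𝕜 := ℝ) (ℝ ∙ v)ᗮ
  rw [Submodule.orthogonal_orthogonal, finrank_span_singleton hv, pow_one] at this
  exact this

theorem exists_ne_zero_forall_inner_eq_zero {d k : ℕ} (hk : k < d) (x : Fin k → E d) :
    ∃ v : E d, v ≠ 0 ∧ ∀ i, inner ℝ (x i) v = 0 := by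
  set K := Submodule.span ℝ (Set.range x)
  have h1 : Module.finrank ℝ K ≤ k := by
    simpa [Set.finrank] using finrank_range_le_card (R := ℝ) x
  have h2 := K.finrank_add_finrank_orthogonal
  rw [finrank_euclideanSpace_fin] at h2
  have h3 : 0 < Module.finrank ℝ Kᗮ := by omega
  obtain ⟨v, hv⟩ := Module.finrank_pos_iff_exists_ne_zero.1 h3
  exact ⟨v, by simpa using hv, fun i =>
    (Submodule.mem_orthogonal _ _).1 v.2 _ (Submodule.subset_span ⟨i, rfl⟩)⟩

/-- The isometries act transitively on spheres. -/
theorem exists_linearIsometryEquiv_apply_eq {d : ℕ} {x y : E d} (h : ‖x‖ = ‖y‖) :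
    ∃ R : E d ≃ₗᵢ[ℝ] E d, R x = y := ⟨_, hyperplaneReflection_sub h⟩

/-- The rotations act transitively on spheres. -/
theorem exists_rotation_apply_eq {n : ℕ} {x y : E (n + 2)} (h : ‖x‖ = ‖y‖) :
    ∃ R : E (n + 2) ≃ₗᵢ[ℝ] E (n + 2),
      0 < LinearMap.det (R.toLinearEquiv : E (n + 2) →ₗ[ℝ] E (n + 2)) ∧ R x = y := by
  by_cases hxy : x = y
  · subst hxy
    exact ⟨LinearIsometryEquiv.refl ℝ _, by
      rw [show ((LinearIsometryEquiv.refl ℝ (E (n + 2))).toLinearEquiv :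
        E (n + 2) →ₗ[ℝ] E (n + 2)) = LinearMap.id from rfl, LinearMap.det_id]; exact one_pos, rfl⟩
  -- A second reflection, in a vector orthogonal to `y`, fixes `y` and restores determinant `1`.
  -- Such a vector exists because the dimension is at least two.
  · obtain ⟨v, hv, hvy⟩ := exists_ne_zero_forall_inner_eq_zero (d := n + 2) (k := 1)
      (by omega) (fun _ => y)
    refine ⟨(hyperplaneReflection (x - y)).trans (hyperplaneReflection v), ?_, ?_⟩
    · rw [show (((hyperplaneReflection (x - y)).trans (hyperplaneReflection v)).toLinearEquiv :
        E (n + 2) →ₗ[ℝ] E (n + 2)) =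
        ((hyperplaneReflection v).toLinearEquiv : E (n + 2) →ₗ[ℝ] E (n + 2)) ∘ₗ
        ((hyperplaneReflection (x - y)).toLinearEquiv : E (n + 2) →ₗ[ℝ] E (n + 2)) from rfl,
        LinearMap.det_comp, det_hyperplaneReflection hv,
        det_hyperplaneReflection (sub_ne_zero.2 hxy)]
      norm_num
    · rw [LinearIsometryEquiv.trans_apply, hyperplaneReflection_sub h,
        hyperplaneReflection_of_inner_eq_zero]
      rw [real_inner_comm]; exact hvy 0

end Determinant

/-! ### The wedge product -/

section Wedge

theorem inner_wedge {n : ℕ} (y : Fin n → E (n + 1)) (i : Fin n) : inner ℝ (y i) (wedge y) = 0 := by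
  rw [← vdet_snoc_eq_inner_wedge]
  exact vdet_eq_zero_of_eq (i := Fin.castSucc i) (j := Fin.last n) (Fin.castSucc_lt_last i).ne
    (by simp)

theorem measurable_wedge {n : ℕ} : Measurable (wedge : (Fin n → E (n + 1)) → E (n + 1)) := by
  unfold wedge
  refine (PiLp.continuous_toLp 2 _).measurable.comp (measurable_pi_lambda _ fun j => ?_)
  refine measurable_vdet.comp (measurable_pi_lambda _ fun i => ?_)
  refine Fin.lastCases ?_ (fun i => ?_) i
  · simp
  · simp only [Fin.snoc_castSucc]; fun_prop

/-- The wedge is dual to the determinant, which rotations preserve. A reflection would introduce a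
sign. -/
theorem wedge_comp_linearIsometryEquiv {n : ℕ} (R : E (n + 1) ≃ₗᵢ[ℝ] E (n + 1))
    (hR : 0 < LinearMap.det (R.toLinearEquiv : E (n + 1) →ₗ[ℝ] E (n + 1)))
    (y : Fin n → E (n + 1)) : wedge (fun i => R (y i)) = R (wedge y) := by
  refine ext_inner_left ℝ fun v => ?_
  obtain ⟨w, rfl⟩ := R.surjective v
  rw [R.inner_map_map, ← vdet_snoc_eq_inner_wedge, ← vdet_snoc_eq_inner_wedge,
    ← vdet_comp_linearIsometryEquiv R hR (Fin.snoc y w)]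
  congr 1
  ext1 i
  refine Fin.lastCases ?_ (fun i => ?_) i <;> simp

theorem pairwise_orthogonal_snoc {d k : ℕ} {x : Fin k → E d} {v : E d}
    (hx : ∀ i j, i ≠ j → inner ℝ (x i) (x j) = 0) (hv : ∀ i, inner ℝ (x i) v = 0) :
    ∀ i j, i ≠ j → inner ℝ ((Fin.snoc x v : Fin (k + 1) → E d) i)
      ((Fin.snoc x v : Fin (k + 1) → E d) j) = 0 := by
  intro i j
  refine Fin.lastCases ?_ (fun i => ?_) i <;> refine Fin.lastCases ?_ (fun j => ?_) j
  · simp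
  · intro _; simp only [Fin.snoc_last, Fin.snoc_castSucc]; rw [real_inner_comm]; exact hv j
  · intro _; simp only [Fin.snoc_last, Fin.snoc_castSucc]; exact hv i
  · intro h; simp only [Fin.snoc_castSucc]; exact hx i j fun h' => h (by rw [h'])

/-- Equality in Hadamard gives `|⟨v, w⟩| = ‖v‖` for `w = wedge y` and every `v` orthogonal to the `y
i`. Taking `v = w` yields `‖w‖² = ‖w‖`, and a nonzero such `v` rules out `w = 0`. -/
theorem norm_wedge {n : ℕ} {y : Fin n → E (n + 1)}
    (hy : ∀ i j, i ≠ j → inner ℝ (y i) (y j) = 0) (h1 : ∀ i, ‖y i‖ = 1) : ‖wedge y‖ = 1 := by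
  obtain ⟨v, hv, hvy⟩ := exists_ne_zero_forall_inner_eq_zero (Nat.lt_succ_self n) y
  have key : ∀ v : E (n + 1), (∀ i, inner ℝ (y i) v = 0) → |inner ℝ v (wedge y)| = ‖v‖ := by
    intro v hv
    rw [← vdet_snoc_eq_inner_wedge, abs_vdet_of_pairwise_orthogonal (pairwise_orthogonal_snoc hy hv),
      Fin.prod_univ_castSucc]
    simp [h1]
  have h2 := key (wedge y) (inner_wedge y)
  rw [real_inner_self_eq_norm_sq, abs_of_nonneg (sq_nonneg _)] at h2
  have h3 : ‖wedge y‖ ≠ 0 := by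
    intro h0
    have := key v hvy
    rw [norm_eq_zero.1 h0, inner_zero_right, abs_zero] at this
    exact hv (norm_eq_zero.1 this.symm)
  exact mul_right_cancel₀ h3 (by linarith [sq ‖wedge y‖])

end Wedge

/-! ### Hausdorff measure of the unit sphere -/

section SphereMeasure

/-- Used to project the faces of a cube radially onto the sphere by Lipschitz maps. -/
theorem norm_inv_smul_sub_le {F : Type*} [NormedAddCommGroup F] [NormedSpace ℝ F] {x y : F}
    (hx : 1 ≤ ‖x‖) (hy : 1 ≤ ‖y‖) : ‖‖x‖⁻¹ • x - ‖y‖⁻¹ • y‖ ≤ 2 * ‖x - y‖ := by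
  have hx0 : 0 < ‖x‖ := by linarith
  have hy0 : 0 < ‖y‖ := by linarith
  have h1 : ‖x‖⁻¹ ≤ 1 := inv_le_one_of_one_le₀ hx
  have e : ‖x‖⁻¹ • x - ‖y‖⁻¹ • y = ‖x‖⁻¹ • (x - y) + (‖x‖⁻¹ * (‖y‖ - ‖x‖)) • (‖y‖⁻¹ • y) := by
    rw [smul_sub, smul_smul (_ * _), mul_assoc, sub_mul, mul_inv_cancel₀ hy0.ne', mul_sub,
      mul_one, ← mul_assoc, inv_mul_cancel₀ hx0.ne', one_mul, sub_smul]
    abel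
  have h2 : ‖‖y‖⁻¹ • y‖ = 1 := by
    rw [norm_smul, norm_inv, norm_norm, inv_mul_cancel₀ hy0.ne']
  rw [e]
  refine (norm_add_le _ _).trans ?_
  rw [norm_smul, norm_smul _ (‖y‖⁻¹ • y), h2, mul_one, norm_mul, norm_inv, norm_norm,
    Real.norm_eq_abs (‖y‖ - ‖x‖)]
  have h3 : |‖y‖ - ‖x‖| ≤ ‖x - y‖ := by rw [norm_sub_rev]; exact abs_norm_sub_norm_le y x
  nlinarith [mul_le_mul h1 h3 (abs_nonneg _) zero_le_one,
    mul_le_mul h1 (le_refl ‖x - y‖) (norm_nonneg _) zero_le_one]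

/-- The unit sphere of `ℝ^(s+1)` has positive `s`-dimensional Hausdorff measure. -/
theorem hausdorffMeasure_sphere_ne_zero (s : ℕ) : μH[(s : ℝ)] (Metric.sphere (0 : E (s + 1)) 1) ≠ 0 := by
  -- Forgetting the last coordinate is 1-Lipschitz and maps the sphere onto a set containing the
  -- open unit ball, of positive Lebesgue measure.
  set f : E (s + 1) → (Fin s → ℝ) := fun x i => x (Fin.castSucc i) with hf
  have hlip : LipschitzOnWith 1 f (Metric.sphere (0 : E (s + 1)) 1) := by
    refine LipschitzOnWith.of_dist_le_mul fun x _ y _ => ?_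
    rw [NNReal.coe_one, one_mul, dist_pi_le_iff dist_nonneg]
    intro i
    rw [dist_eq_norm, dist_eq_norm]
    exact PiLp.norm_apply_le (x - y) (Fin.castSucc i)
  set U : Set (Fin s → ℝ) := {z | ∑ i, z i ^ 2 < 1} with hU
  have hUo : IsOpen U := isOpen_lt (by fun_prop) continuous_const
  have hsub : U ⊆ f '' Metric.sphere (0 : E (s + 1)) 1 := by
    intro z hz
    refine ⟨WithLp.toLp 2 (Fin.snoc z (Real.sqrt (1 - ∑ i, z i ^ 2)) : Fin (s + 1) → ℝ), ?_, ?_⟩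
    · rw [mem_sphere_zero_iff_norm, EuclideanSpace.norm_eq, Fin.sum_univ_castSucc]
      have : 0 ≤ 1 - ∑ i, z i ^ 2 := by have : ∑ i, z i ^ 2 < 1 := hz; linarith
      simp [Real.sq_sqrt this]
    · ext i; simp [hf]
  have hpos : 0 < volume U := hUo.measure_pos _ ⟨0, by simp [hU]⟩
  have h1 := hlip.hausdorffMeasure_image_le (d := (s : ℝ)) (Nat.cast_nonneg s)
  have h2 : μH[(s : ℝ)] (f '' Metric.sphere (0 : E (s + 1)) 1) ≠ 0 := by
    have h3 : (μH[(s : ℝ)] : Measure (Fin s → ℝ)) = volume := by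
      have := hausdorffMeasure_pi_real (ι := Fin s)
      rwa [Fintype.card_fin] at this
    rw [h3]
    exact (hpos.trans_le (measure_mono hsub)).ne'
  intro h0
  rw [h0, mul_zero] at h1
  exact h2 (le_antisymm h1 bot_le)

/-- The unit sphere of `ℝ^(s+1)` has finite `s`-dimensional Hausdorff measure. -/
theorem hausdorffMeasure_sphere_ne_top (s : ℕ) : μH[(s : ℝ)] (Metric.sphere (0 : E (s + 1)) 1) ≠ ⊤ := by
  set C : Set (Fin s → ℝ) := Set.Icc (fun _ => -1) (fun _ => 1) with hC
  -- For `ε = ±1`, `g i ε` parametrizes a face of the cube. Radial projections of the faces cover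
  -- the sphere.
  set g : Fin (s + 1) → SignType → (Fin s → ℝ) → E (s + 1) := fun i ε u =>
    WithLp.toLp 2 (Fin.insertNth i (ε : ℝ) u : Fin (s + 1) → ℝ) with hg
  have hgi : ∀ i ε u, g i ε u i = (ε : ℝ) := fun i ε u => by simp [hg]
  have hgj : ∀ i ε u j, g i ε u (i.succAbove j) = u j := fun i ε u j => by simp [hg]
  have hnorm : ∀ i ε u, ε ≠ 0 → 1 ≤ ‖g i ε u‖ := by
    intro i ε u hε
    refine le_trans ?_ (PiLp.norm_apply_le (g i ε u) i)
    rw [hgi]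
    cases ε <;> simp_all
  -- The factor `√s` compares the Euclidean norm with the sup norm of `Fin s → ℝ`.
  have hglip : ∀ i ε u v, ‖g i ε u - g i ε v‖ ≤ Real.sqrt s * ‖u - v‖ := by
    intro i ε u v
    rw [EuclideanSpace.norm_eq, Fin.sum_univ_succAbove _ i]
    simp only [PiLp.sub_apply, hgi, hgj, sub_self, norm_zero]
    have : ∑ j, ‖u j - v j‖ ^ 2 ≤ s * ‖u - v‖ ^ 2 := by
      calc ∑ j, ‖u j - v j‖ ^ 2 ≤ ∑ j : Fin s, ‖u - v‖ ^ 2 := by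
            refine Finset.sum_le_sum fun j _ => ?_
            gcongr
            exact norm_le_pi_norm (u - v) j
        _ = s * ‖u - v‖ ^ 2 := by simp
    calc Real.sqrt (0 ^ 2 + ∑ j, ‖u j - v j‖ ^ 2) ≤ Real.sqrt (s * ‖u - v‖ ^ 2) := by
          apply Real.sqrt_le_sqrt; linarith
      _ = Real.sqrt s * ‖u - v‖ := by
          rw [Real.sqrt_mul (Nat.cast_nonneg s), Real.sqrt_sq (norm_nonneg _)]
  set F : Fin (s + 1) → SignType → (Fin s → ℝ) → E (s + 1) := fun i ε u =>
    ‖g i ε u‖⁻¹ • g i ε u with hF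
  have hFlip : ∀ i ε, ε ≠ 0 → LipschitzOnWith (Real.toNNReal (2 * Real.sqrt s)) (F i ε) C := by
    intro i ε hε
    refine LipschitzOnWith.of_dist_le_mul fun u _ v _ => ?_
    rw [Real.coe_toNNReal _ (by positivity), dist_eq_norm, dist_eq_norm]
    refine (norm_inv_smul_sub_le (hnorm i ε u hε) (hnorm i ε v hε)).trans ?_
    have := hglip i ε u v
    nlinarith
  have hfin : ∀ i ε, ε ≠ 0 → μH[(s : ℝ)] (F i ε '' C) < ⊤ := by
    intro i ε hε
    refine ((hFlip i ε hε).hausdorffMeasure_image_le (d := (s : ℝ)) (Nat.cast_nonneg s)).trans_lt ?_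
    have h3 : (μH[(s : ℝ)] : Measure (Fin s → ℝ)) = volume := by
      have := hausdorffMeasure_pi_real (ι := Fin s)
      rwa [Fintype.card_fin] at this
    rw [h3]
    exact ENNReal.mul_lt_top (ENNReal.rpow_lt_top_of_nonneg (Nat.cast_nonneg s) ENNReal.coe_ne_top)
      isCompact_Icc.measure_lt_top
  have hcover : Metric.sphere (0 : E (s + 1)) 1 ⊆
      ⋃ i, (F i 1 '' C ∪ F i (-1) '' C) := by
    intro y hy
    rw [mem_sphere_zero_iff_norm] at hy
    -- Dividing `y` by its largest coordinate in absolute value lands on a face of the cube.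
    obtain ⟨i, -, hi⟩ := Finset.exists_max_image Finset.univ (fun i => |y i|) Finset.univ_nonempty
    have hyi : 0 < |y i| := by
      by_contra h
      have h0 : y = 0 := by
        ext j
        exact abs_eq_zero.1 (le_antisymm ((hi j (Finset.mem_univ j)).trans (not_lt.1 h)) (abs_nonneg _))
      rw [h0, norm_zero] at hy
      exact zero_ne_one hy
    have hmem : (fun j => |y i|⁻¹ * y (i.succAbove j)) ∈ C := by
      rw [hC, Set.mem_Icc, Pi.le_def, Pi.le_def, ← forall_and]
      intro j
      rw [← abs_le, abs_mul, abs_inv, abs_abs, inv_mul_le_one₀ hyi]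
      exact hi _ (Finset.mem_univ _)
    have key : ∀ ε : SignType, ε ≠ 0 → (ε : ℝ) = |y i|⁻¹ * y i →
        F i ε (fun j => |y i|⁻¹ * y (i.succAbove j)) = y := by
      intro ε hε he
      have hgy : g i ε (fun j => |y i|⁻¹ * y (i.succAbove j)) = |y i|⁻¹ • y := by
        ext j
        refine Fin.succAboveCases i ?_ (fun j => ?_) j
        · rw [hgi, he]; simp
        · rw [hgj]; simp
      rw [hF]
      simp only [hgy]
      rw [norm_smul, hy, mul_one, norm_inv, Real.norm_eq_abs, abs_abs, inv_inv, smul_smul,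
        mul_inv_cancel₀ hyi.ne', one_smul]
    rw [Set.mem_iUnion]
    refine ⟨i, ?_⟩
    rcases abs_cases (y i) with ⟨h, _⟩ | ⟨h, _⟩
    · refine Or.inl ⟨_, hmem, key 1 (by decide) ?_⟩
      rw [h, inv_mul_cancel₀ (by rw [← h]; exact hyi.ne')]; simp
    · refine Or.inr ⟨_, hmem, key (-1) (by decide) ?_⟩
      have : y i ≠ 0 := by rw [← abs_pos]; exact hyi
      rw [h]; simp; field_simp
  refine ((measure_mono hcover).trans_lt ((measure_iUnion_le _).trans_lt ?_)).ne
  rw [tsum_fintype]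
  refine ENNReal.sum_lt_top.2 fun i _ => (measure_union_le _ _).trans_lt ?_
  exact ENNReal.add_lt_top.2 ⟨hfin i 1 (by decide), hfin i (-1) (by decide)⟩

end SphereMeasure

/-! ### Uniform laws on orthogonal spheres -/

section UniformOrthSphere

/-- Nonzero pairwise orthogonal vectors. -/
def IsOrthogonalFrame {d k : ℕ} (x : Fin k → E d) : Prop :=
  (∀ i, x i ≠ 0) ∧ ∀ i j, i ≠ j → inner ℝ (x i) (x j) = 0

theorem measurableSet_orthSphere {d k : ℕ} (x : Fin k → E d) : MeasurableSet (orthSphere x) := by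
  have : orthSphere x = {y | ‖y‖ = 1} ∩ ⋂ i, {y | inner ℝ (x i) y = 0} := by
    ext y; simp [orthSphere]
  rw [this]
  refine (IsClosed.inter (isClosed_eq continuous_norm continuous_const)
    (isClosed_iInter fun i => isClosed_eq ?_ continuous_const)).measurableSet
  fun_prop

theorem measurableSet_smul_orthSphere {d k : ℕ} (x : Fin k → E d) (r : ℝ) :
    MeasurableSet (r • orthSphere x) := (measurableSet_orthSphere x).const_smul₀ r

/-- An orthonormal basis of the orthogonal complement, of dimension `s + 1`, reduces the measure of
the sphere to the standard one. -/
theorem exists_isometry_image_sphere_eq_orthSphere {d k s : ℕ} (hd : d = k + s + 1)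
    {x : Fin k → E d} (hx : IsOrthogonalFrame x) :
    ∃ f : E (s + 1) → E d, Isometry f ∧ f '' Metric.sphere 0 1 = orthSphere x := by
  set V := (Submodule.span ℝ (Set.range x))ᗮ with hV
  have hli : LinearIndependent ℝ x :=
    linearIndependent_of_ne_zero_of_inner_eq_zero hx.1 fun i j h => hx.2 i j h
  have h1 : Module.finrank ℝ (Submodule.span ℝ (Set.range x)) = k := by
    simpa using finrank_span_eq_card hli
  have h2 := (Submodule.span ℝ (Set.range x)).finrank_add_finrank_orthogonal
  rw [finrank_euclideanSpace_fin, h1] at h2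
  have h3 : Module.finrank ℝ V = s + 1 := by rw [hV]; omega
  let b : OrthonormalBasis (Fin (s + 1)) ℝ V :=
    (stdOrthonormalBasis ℝ V).reindex (finCongr h3)
  let f : E (s + 1) →ₗᵢ[ℝ] E d := V.subtypeₗᵢ.comp b.repr.symm.toLinearIsometry
  have hmem : ∀ y, y ∈ V ↔ ∀ i, inner ℝ (x i) y = 0 := by
    intro y
    rw [hV, Submodule.mem_orthogonal]
    refine ⟨fun h i => h _ (Submodule.subset_span ⟨i, rfl⟩), fun h u hu => ?_⟩
    induction hu using Submodule.span_induction with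
    | mem u hu => obtain ⟨i, rfl⟩ := hu; exact h i
    | zero => simp
    | add u v _ _ hu hv => rw [inner_add_left, hu, hv, add_zero]
    | smul c u _ hu => rw [inner_smul_left, hu, mul_zero]
  refine ⟨f, f.isometry, ?_⟩
  ext y
  constructor
  · rintro ⟨z, hz, rfl⟩
    exact ⟨by rw [f.norm_map]; simpa using hz, (hmem _).1 (b.repr.symm z).2⟩
  · rintro ⟨hy1, hy2⟩
    refine ⟨b.repr ⟨y, (hmem y).2 hy2⟩, ?_, ?_⟩
    · rw [mem_sphere_zero_iff_norm, LinearIsometryEquiv.norm_map]; exact hy1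
    · change ((b.repr.symm (b.repr ⟨y, (hmem y).2 hy2⟩) : V) : E d) = y
      rw [LinearIsometryEquiv.symm_apply_apply]

theorem hausdorffMeasure_orthSphere {d k : ℕ} (hk : k < d) {x : Fin k → E d}
    (hx : IsOrthogonalFrame x) :
    μH[(d : ℝ) - k - 1] (orthSphere x) ≠ 0 ∧ μH[(d : ℝ) - k - 1] (orthSphere x) ≠ ⊤ := by
  obtain ⟨s, rfl⟩ : ∃ s, d = k + s + 1 := ⟨d - k - 1, by omega⟩
  obtain ⟨f, hf, hfS⟩ := exists_isometry_image_sphere_eq_orthSphere rfl hx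
  rw [← hfS, show (((k + s + 1 : ℕ) : ℝ) - k - 1) = s by push_cast; ring,
    hf.hausdorffMeasure_image (Or.inl (Nat.cast_nonneg s))]
  exact ⟨hausdorffMeasure_sphere_ne_zero s, hausdorffMeasure_sphere_ne_top s⟩

/-- The factor `c` cancels in the normalization. This serves both isometries (`c = 1`) and
dilations. -/
theorem cond_image_of_map_eq_smul {α : Type*} [MeasurableSpace α] {μ : Measure α} (e : α ≃ᵐ α)
    {c : ENNReal} (h0 : c ≠ 0) (hc : c ≠ ⊤) (he : μ.map e = c • μ) (S : Set α) :
    ProbabilityTheory.cond μ (e '' S) = (ProbabilityTheory.cond μ S).map e := by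
  have h1 : μ S = c * μ (e '' S) := by
    have := e.map_apply (μ := μ) (e '' S)
    rw [he, e.injective.preimage_image] at this
    rw [← this]; simp
  have h2 : (μ.restrict S).map e = c • μ.restrict (e '' S) := by
    have := e.restrict_map μ (e '' S)
    rw [e.injective.preimage_image, he] at this
    rw [← this, Measure.restrict_smul]
  rw [ProbabilityTheory.cond, ProbabilityTheory.cond, Measure.map_smul, h2, smul_smul, h1,
    ENNReal.mul_inv (Or.inl h0) (Or.inl hc), mul_right_comm, ENNReal.inv_mul_cancel h0 hc, one_mul]

theorem map_smul_hausdorffMeasure {d : ℕ} {s r : ℝ} (hs : 0 ≤ s) (hr : r ≠ 0) :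
    (μH[s] : Measure (E d)).map (MeasurableEquiv.smul₀ r hr) =
      ((‖r⁻¹‖₊ ^ s : NNReal) : ENNReal) • (μH[s] : Measure (E d)) := by
  ext A hA
  rw [MeasurableEquiv.map_apply, Measure.smul_apply,
    show (MeasurableEquiv.smul₀ r hr : E d → E d) ⁻¹' A = r⁻¹ • A from Set.preimage_smul₀ hr A,
    Measure.hausdorffMeasure_smul₀ hs (inv_ne_zero hr)]
  rfl

theorem image_linearIsometryEquiv_smul_orthSphere {d k : ℕ} (R : E d ≃ₗᵢ[ℝ] E d) (x : Fin k → E d)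
    (r : ℝ) : r • orthSphere (fun i => R (x i)) = R '' (r • orthSphere x) := by
  rw [← Set.image_smul, ← Set.image_smul, Set.image_image]
  have : orthSphere (fun i => R (x i)) = R '' orthSphere x := by
    ext y
    obtain ⟨z, rfl⟩ := R.surjective y
    simp [orthSphere]
  rw [this, Set.image_image]
  simp

theorem uniformOrthSphere_comp_linearIsometryEquiv {d k : ℕ} (R : E d ≃ₗᵢ[ℝ] E d)
    (x : Fin k → E d) (r : ℝ) :
    uniformOrthSphere (fun i => R (x i)) r = (uniformOrthSphere x r).map R := by
  rw [uniformOrthSphere, image_linearIsometryEquiv_smul_orthSphere]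
  refine cond_image_of_map_eq_smul R.toHomeomorph.toMeasurableEquiv one_ne_zero ENNReal.one_ne_top
    ?_ _
  rw [one_smul]
  exact R.toIsometryEquiv.map_hausdorffMeasure _

theorem uniformOrthSphere_eq_map_smul {d k : ℕ} (hk : k < d) (x : Fin k → E d) {r : ℝ}
    (hr : r ≠ 0) : uniformOrthSphere x r = (uniformOrthSphere x 1).map fun y => r • y := by
  have hs : (0 : ℝ) ≤ (d : ℝ) - k - 1 := by
    have : ((k + 1 : ℕ) : ℝ) ≤ d := by exact_mod_cast hk
    push_cast at this; linarith
  have := cond_image_of_map_eq_smul (MeasurableEquiv.smul₀ r hr) (c := ((‖r⁻¹‖₊ ^ ((d : ℝ) - k - 1) : NNReal) : ENNReal))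
    (μ := (μH[(d : ℝ) - k - 1] : Measure (E d))) ?_ ENNReal.coe_ne_top
    (map_smul_hausdorffMeasure hs hr) (orthSphere x)
  · rw [uniformOrthSphere, uniformOrthSphere, one_smul]
    exact this
  · rw [ENNReal.coe_ne_zero]
    exact (NNReal.rpow_pos (by simpa using hr)).ne'

theorem isProbabilityMeasure_uniformOrthSphere {d k : ℕ} (hk : k < d) {x : Fin k → E d}
    (hx : IsOrthogonalFrame x) {r : ℝ} (hr : r ≠ 0) :
    IsProbabilityMeasure (uniformOrthSphere x r) := by
  have h1 : IsProbabilityMeasure (uniformOrthSphere x 1) := by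
    rw [uniformOrthSphere, one_smul]
    obtain ⟨h0, ht⟩ := hausdorffMeasure_orthSphere hk hx
    exact ProbabilityTheory.cond_isProbabilityMeasure_of_finite h0 ht
  rw [uniformOrthSphere_eq_map_smul hk x hr]
  exact Measure.isProbabilityMeasure_map (by fun_prop)

/-- Valid for degenerate `x` and `r` too: conditioning on a set of zero or infinite measure gives
the zero measure. -/
theorem ae_uniformOrthSphere {d k : ℕ} (x : Fin k → E d) (r : ℝ) :
    ∀ᵐ y ∂uniformOrthSphere x r, ‖y‖ = |r| ∧ ∀ i, inner ℝ (x i) y = 0 := by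
  filter_upwards [ProbabilityTheory.ae_cond_mem (measurableSet_smul_orthSphere x r)] with y hy
  obtain ⟨z, hz, rfl⟩ := hy
  refine ⟨by simp [norm_smul, hz.1], fun i => ?_⟩
  change inner ℝ (x i) (r • z) = 0
  rw [inner_smul_right, hz.2 i, mul_zero]

end UniformOrthSphere

/-! ### Radial measures are determined by their radial laws -/

section RadialMeasures

theorem charFun_comp_linearIsometryEquiv {d : ℕ} {μ : Measure (E d)} (R : E d ≃ₗᵢ[ℝ] E d)
    (hR : μ.map R = μ) (x : E d) : charFun μ (R x) = charFun μ x := by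
  conv_lhs => rw [← hR]
  rw [charFun_apply, charFun_apply, integral_map (by fun_prop)
    (by fun_prop)]
  simp

/-- A finite measure is determined by its radial law when its characteristic function is radial. -/
theorem measure_eq_of_radialLaw_eq {d : ℕ} (hd : 0 < d) {μ ν : Measure (E d)}
    [IsProbabilityMeasure μ] [IsProbabilityMeasure ν]
    (hμ : ∀ x y, ‖x‖ = ‖y‖ → charFun μ x = charFun μ y)
    (hν : ∀ x y, ‖x‖ = ‖y‖ → charFun ν x = charFun ν y)
    (h : radialLaw μ = radialLaw ν) : μ = ν := by
  set σ : Measure (E d) := uniformOrthSphere (Fin.elim0 : Fin 0 → E d) 1 with hσ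
  have : IsProbabilityMeasure σ := isProbabilityMeasure_uniformOrthSphere hd
    ⟨fun i => i.elim0, fun i => i.elim0⟩ one_ne_zero
  have hσn : ∀ᵐ y ∂σ, ‖y‖ = 1 := by
    filter_upwards [ae_uniformOrthSphere (Fin.elim0 : Fin 0 → E d) 1] with y hy
    simpa using hy.1
  have hσinv : ∀ R : E d ≃ₗᵢ[ℝ] E d, σ.map R = σ := by
    intro R
    rw [hσ, ← uniformOrthSphere_comp_linearIsometryEquiv]
    congr 1
    ext1 i
    exact i.elim0
  have hσc : ∀ x y, ‖x‖ = ‖y‖ → charFun σ x = charFun σ y := by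
    intro x y hxy
    obtain ⟨R, rfl⟩ := exists_linearIsometryEquiv_apply_eq hxy
    exact (charFun_comp_linearIsometryEquiv R (hσinv R) x).symm
  set e : E d := EuclideanSpace.single ⟨0, hd⟩ 1
  have he : ‖e‖ = 1 := by simp [e]
  have key : ∀ (μ : Measure (E d)) [IsProbabilityMeasure μ],
      (∀ x y, ‖x‖ = ‖y‖ → charFun μ x = charFun μ y) → ∀ ξ,
      charFun μ ξ = ∫ r, charFun σ ((‖ξ‖ * r) • e) ∂(radialLaw μ) := by
    intro μ _ hμ ξ
    -- Average over directions, exchange the integrals, and use that `charFun σ` is radial: only the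
    -- law of `‖x‖` remains.
    calc charFun μ ξ = ∫ u, charFun μ (‖ξ‖ • u) ∂σ := by
          rw [integral_congr_ae (g := fun _ => charFun μ ξ)]
          · simp
          · filter_upwards [hσn] with u hu
            exact hμ _ _ (by simp [norm_smul, hu])
      _ = ∫ x, charFun σ (‖ξ‖ • x) ∂μ := by
          simp only [charFun_apply]
          rw [integral_integral_swap]
          · congr 1; ext x; congr 1; ext u
            rw [inner_smul_right, inner_smul_right, real_inner_comm]
          · refine Integrable.of_bound (C := 1) (by fun_prop) (Filter.Eventually.of_forall fun q => ?_)
            exact (Complex.norm_exp_ofReal_mul_I _).le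
      _ = ∫ x, charFun σ ((‖ξ‖ * ‖x‖) • e) ∂μ := by
          congr 1; ext x
          exact hσc _ _ (by simp [norm_smul, he])
      _ = ∫ r, charFun σ ((‖ξ‖ * r) • e) ∂(radialLaw μ) := by
          rw [radialLaw, integral_map (by fun_prop)]
          exact (measurable_charFun.comp (by fun_prop)).aestronglyMeasurable
  refine Measure.ext_of_charFun (funext fun ξ => ?_)
  rw [key μ hμ, key ν hν, h]

end RadialMeasures

/-! ### A measurable isometry adapted to an orthogonal frame -/

section Frames

/-- The `i`-th vector of the canonical basis of `ℝ^d`, and `0` when `d ≤ i`. -/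
def stdVec (d i : ℕ) : E d := if h : i < d then EuclideanSpace.single ⟨i, h⟩ 1 else 0

theorem norm_stdVec {d i : ℕ} (h : i < d) : ‖stdVec d i‖ = 1 := by simp [stdVec, h]

theorem inner_stdVec {d i j : ℕ} (h : i ≠ j) : inner ℝ (stdVec d i) (stdVec d j) = 0 := by
  unfold stdVec
  by_cases hi : i < d <;> by_cases hj : j < d
  · rw [dif_pos hi, dif_pos hj, EuclideanSpace.inner_single_left, PiLp.single_apply]
    simp [h]
  all_goals simp [hi, hj]

/-- A product of hyperplane reflections taking the first canonical vectors to the normalized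
vectors of an orthogonal frame, and depending measurably on the frame. -/
def frameIsometry {d : ℕ} : (k : ℕ) → (Fin k → E d) → (E d ≃ₗᵢ[ℝ] E d)
  | 0, _ => LinearIsometryEquiv.refl ℝ _
  | k + 1, x => (frameIsometry k (Fin.init x)).trans (hyperplaneReflection
      (frameIsometry k (Fin.init x) (stdVec d k) - ‖x (Fin.last k)‖⁻¹ • x (Fin.last k)))

theorem measurable_frameIsometry {d : ℕ} (k : ℕ) :
    Measurable fun p : (Fin k → E d) × E d => frameIsometry k p.1 p.2 := by
  induction k with
  | zero => exact measurable_snd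
  | succ k ih =>
    simp only [frameIsometry, LinearIsometryEquiv.trans_apply, hyperplaneReflection_apply]
    have hi : Measurable fun p : (Fin (k + 1) → E d) × E d => (Fin.init p.1 : Fin k → E d) :=
      measurable_pi_lambda _ fun i => (measurable_pi_apply _).comp measurable_fst
    have h1 : Measurable fun p : (Fin (k + 1) → E d) × E d =>
        frameIsometry k (Fin.init p.1) p.2 := ih.comp (hi.prodMk measurable_snd)
    have h2 : Measurable fun p : (Fin (k + 1) → E d) × E d =>
        frameIsometry k (Fin.init p.1) (stdVec d k) := ih.comp (hi.prodMk measurable_const)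
    have h3 : Measurable fun p : (Fin (k + 1) → E d) × E d => p.1 (Fin.last k) :=
      (measurable_pi_apply _).comp measurable_fst
    fun_prop

theorem IsOrthogonalFrame.init {d k : ℕ} {x : Fin (k + 1) → E d} (hx : IsOrthogonalFrame x) :
    IsOrthogonalFrame (Fin.init x : Fin k → E d) :=
  ⟨fun _ => hx.1 _, fun _ _ h => hx.2 _ _ fun h' => h (Fin.castSucc_injective _ h')⟩

/-- The last reflection exchanges two unit vectors, both orthogonal to the earlier `x i`, so it
fixes what the previous reflections achieved. -/
theorem frameIsometry_stdVec {d k : ℕ} (hk : k ≤ d) {x : Fin k → E d} (hx : IsOrthogonalFrame x)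
    (i : Fin k) : frameIsometry k x (stdVec d i) = ‖x i‖⁻¹ • x i := by
  induction k with
  | zero => exact i.elim0
  | succ k ih =>
    have ih' := ih (by omega) hx.init
    simp only [frameIsometry, LinearIsometryEquiv.trans_apply]
    refine Fin.lastCases ?_ (fun i => ?_) i
    · refine hyperplaneReflection_sub ?_
      rw [LinearIsometryEquiv.norm_map, norm_stdVec (by omega), norm_smul, norm_inv,
        norm_norm, inv_mul_cancel₀ (norm_ne_zero_iff.2 (hx.1 _))]
    · rw [hyperplaneReflection_of_inner_eq_zero]
      · exact ih' i
      · rw [inner_sub_left, LinearIsometryEquiv.inner_map_map]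
        have h1 : inner ℝ (stdVec d k) (stdVec d (Fin.castSucc i)) = 0 :=
          inner_stdVec i.2.ne'
        rw [h1, Fin.val_castSucc, ih' i, inner_smul_left, inner_smul_right]
        simp [Fin.init, hx.2 _ _ (Fin.castSucc_lt_last i).ne']

theorem orthSphere_smul {d k : ℕ} {c : Fin k → ℝ} (hc : ∀ i, c i ≠ 0) (x : Fin k → E d) :
    orthSphere (fun i => c i • x i) = orthSphere x := by
  ext y
  simp [orthSphere, inner_smul_left, hc]

/-- The uniform laws on the orthogonal spheres are images of a fixed law. -/
theorem uniformOrthSphere_eq_map_frameIsometry {d k : ℕ} (hk : k < d) {x : Fin k → E d}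
    (hx : IsOrthogonalFrame x) {r : ℝ} (hr : r ≠ 0) :
    uniformOrthSphere x r = (uniformOrthSphere (fun i : Fin k => stdVec d i) 1).map
      fun y => r • frameIsometry k x y := by
  have h1 : uniformOrthSphere x 1 =
      uniformOrthSphere (fun i : Fin k => frameIsometry k x (stdVec d i)) 1 := by
    simp only [frameIsometry_stdVec hk.le hx]
    rw [uniformOrthSphere, uniformOrthSphere,
      orthSphere_smul fun i => inv_ne_zero (norm_ne_zero_iff.2 (hx.1 i))]
  rw [uniformOrthSphere_eq_map_smul hk x hr, h1, uniformOrthSphere_comp_linearIsometryEquiv,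
    Measure.map_map (by fun_prop) (by fun_prop)]
  rfl

theorem isOrthogonalFrame_stdVec {d k : ℕ} (hk : k ≤ d) :
    IsOrthogonalFrame (fun i : Fin k => stdVec d i) :=
  ⟨fun i => norm_ne_zero_iff.1 (by rw [norm_stdVec (i.2.trans_le hk)]; exact one_ne_zero),
    fun i j h => inner_stdVec fun h' => h (Fin.ext h')⟩

end Frames

/-! ### Mixtures of measures -/

section Bind

variable {α β γ : Type*} [MeasurableSpace α] [MeasurableSpace β] [MeasurableSpace γ]

/-- The source of kernel measurability: a fixed law transported by a jointly measurable map. -/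
theorem measurable_map_prodMk {g : α × β → γ} (hg : Measurable g) (σ : Measure β) [SFinite σ] :
    Measurable fun a => σ.map fun b => g (a, b) := by
  refine Measure.measurable_of_measurable_coe _ fun s hs => ?_
  have : ∀ a, (σ.map fun b => g (a, b)) s = σ (Prod.mk a ⁻¹' (g ⁻¹' s)) := fun a =>
    Measure.map_apply (hg.comp measurable_prodMk_left) hs
  simp only [this]
  exact measurable_measure_prodMk_left (hg hs)

theorem map_bind_eq {m : Measure α} {κ : α → Measure β} (hκ : AEMeasurable κ m) {g : β → γ}
    (hg : Measurable g) : (m.bind κ).map g = m.bind fun a => (κ a).map g := by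
  have hκg : AEMeasurable (fun a => (κ a).map g) m :=
    (Measure.measurable_map g hg).comp_aemeasurable hκ
  ext s hs
  rw [Measure.map_apply hg hs, Measure.bind_apply (hg hs) hκ, Measure.bind_apply hs hκg]
  simp only [Measure.map_apply hg hs]

theorem bind_map_eq {m : Measure α} {g : α → β} (hg : Measurable g) {κ : β → Measure γ}
    (hκ : AEMeasurable κ (m.map g)) : (m.map g).bind κ = m.bind fun a => κ (g a) := by
  rw [Measure.bind, Measure.bind, AEMeasurable.map_map_of_aemeasurable hκ hg.aemeasurable]
  rfl

theorem ae_bind_of_ae_ae {m : Measure α} {κ : α → Measure β} (hκ : AEMeasurable κ m)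
    {p : β → Prop} (hp : MeasurableSet {b | p b}) (h : ∀ᵐ a ∂m, ∀ᵐ b ∂κ a, p b) :
    ∀ᵐ b ∂m.bind κ, p b := by
  have hκp : AEMeasurable (fun a => κ a {b | p b}ᶜ) m :=
    (Measure.measurable_coe hp.compl).comp_aemeasurable hκ
  rw [ae_iff, ← Set.compl_ofPred, Measure.bind_apply hp.compl hκ, lintegral_eq_zero_iff' hκp]
  filter_upwards [h] with a ha
  exact ha

end Bind

/-! ### The law of the first `d - 1` vectors -/

section SphericalLaw

theorem measurable_snoc {d k : ℕ} :
    Measurable fun p : (Fin k → E d) × E d => (Fin.snoc p.1 p.2 : Fin (k + 1) → E d) := by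
  refine measurable_pi_lambda _ fun i => ?_
  refine Fin.lastCases ?_ (fun i => ?_) i
  · simpa using measurable_snd
  · simp only [Fin.snoc_castSucc]; fun_prop

theorem measurable_snoc_right {d k : ℕ} (x : Fin k → E d) :
    Measurable fun y => (Fin.snoc x y : Fin (k + 1) → E d) :=
  measurable_snoc.comp measurable_prodMk_left

theorem snoc_comp {d k : ℕ} (R : E d → E d) (x : Fin k → E d) (y : E d) :
    (fun i => R ((Fin.snoc x y : Fin (k + 1) → E d) i)) =
      (Fin.snoc (fun i => R (x i)) (R y) : Fin (k + 1) → E d) := by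
  ext1 i
  refine Fin.lastCases ?_ (fun i => ?_) i <;> simp

/-- The transition kernel of the sequence of vectors. -/
def snocKernel {d k : ℕ} (h : ℝ → ℝ) (x : Fin (k + 1) → E d) : Measure (Fin (k + 2) → E d) :=
  (uniformOrthSphere x (h ‖x 0‖)).map fun y => Fin.snoc x y

theorem sphericalLaw_succ {d : ℕ} (μ₁ : Measure (E d)) (H : ℕ → ℝ → ℝ) (k : ℕ) :
    sphericalLaw μ₁ H (k + 1) = (sphericalLaw μ₁ H k).bind (snocKernel (H (k + 1))) := rfl

/-- Only almost everywhere measurability is claimed, as the representation by `frameIsometry` is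
used at orthogonal frames with positive radius. -/
theorem aemeasurable_snocKernel {d k : ℕ} (hk : k + 1 < d) {m : Measure (Fin (k + 1) → E d)}
    {h : ℝ → ℝ} (hh : Measurable h) (hx : ∀ᵐ x ∂m, IsOrthogonalFrame x)
    (hpos : ∀ᵐ x ∂m, 0 < h ‖x 0‖) : AEMeasurable (snocKernel h) m := by
  have := isProbabilityMeasure_uniformOrthSphere hk (isOrthogonalFrame_stdVec hk.le) one_ne_zero
  have hg : Measurable fun p : (Fin (k + 1) → E d) × E d => h ‖p.1 0‖ • frameIsometry (k + 1) p.1 p.2 :=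
    Measurable.smul (hh.comp ((measurable_pi_apply 0).comp measurable_fst).norm)
      (measurable_frameIsometry (k + 1))
  refine ⟨_, measurable_map_prodMk (measurable_snoc.comp (measurable_fst.prodMk hg))
    (uniformOrthSphere (fun i : Fin (k + 1) => stdVec d i) 1), ?_⟩
  filter_upwards [hx, hpos] with x hx hpos
  rw [snocKernel, uniformOrthSphere_eq_map_frameIsometry hk hx hpos.ne', Measure.map_map]
  · rfl
  · exact measurable_snoc_right x
  · fun_prop

theorem snocKernel_comp_linearIsometryEquiv {d k : ℕ} (R : E d ≃ₗᵢ[ℝ] E d) (h : ℝ → ℝ)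
    (x : Fin (k + 1) → E d) :
    snocKernel h (fun i => R (x i)) = (snocKernel h x).map fun z i => R (z i) := by
  have hT : Measurable fun (z : Fin (k + 2) → E d) i => R (z i) :=
    measurable_pi_lambda _ fun i => R.continuous.measurable.comp (measurable_pi_apply i)
  rw [snocKernel, snocKernel, uniformOrthSphere_comp_linearIsometryEquiv,
    Measure.map_map (measurable_snoc_right _) R.continuous.measurable,
    Measure.map_map hT (measurable_snoc_right _)]
  simp only [LinearIsometryEquiv.norm_map]
  congr 1
  ext1 y
  exact (snoc_comp R x y).symm

/-- The properties of the joint law that are propagated by the construction. -/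
structure IsRadialFrameLaw {d k : ℕ} (μ₁ : Measure (E d)) (H : ℕ → ℝ → ℝ)
    (m : Measure (Fin (k + 1) → E d)) : Prop where
  prob : IsProbabilityMeasure m
  map_zero : m.map (fun x => x 0) = μ₁
  ae_frame : ∀ᵐ x ∂m, IsOrthogonalFrame x
  ae_norm : ∀ᵐ x ∂m, ∀ i : Fin (k + 1), i ≠ 0 → ‖x i‖ = H i ‖x 0‖
  map_isometry : ∀ R : E d ≃ₗᵢ[ℝ] E d, (m.map fun x i => R (x i)) = m

theorem measurableSet_isOrthogonalFrame {d k : ℕ} :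
    MeasurableSet {x : Fin k → E d | IsOrthogonalFrame x} := by
  have : {x : Fin k → E d | IsOrthogonalFrame x} = (⋂ i, {x | x i = 0}ᶜ) ∩
      ⋂ i, ⋂ j, ⋂ (_ : i ≠ j), {x | inner ℝ (x i) (x j) = 0} := by
    ext x; simp [IsOrthogonalFrame]
  rw [this]
  refine MeasurableSet.inter (MeasurableSet.iInter fun i => ?_)
    (MeasurableSet.iInter fun i => MeasurableSet.iInter fun j => MeasurableSet.iInter fun _ => ?_)
  · exact (measurableSet_eq_fun (measurable_pi_apply i) measurable_const).compl
  · exact measurableSet_eq_fun (by fun_prop) measurable_const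

theorem measurableSet_norm_eq {d k : ℕ} {H : ℕ → ℝ → ℝ}
    (hH : ∀ i : Fin (k + 1), i ≠ 0 → Measurable (H i)) :
    MeasurableSet {x : Fin (k + 1) → E d | ∀ i : Fin (k + 1), i ≠ 0 → ‖x i‖ = H i ‖x 0‖} := by
  have : {x : Fin (k + 1) → E d | ∀ i : Fin (k + 1), i ≠ 0 → ‖x i‖ = H i ‖x 0‖} =
      ⋂ i : Fin (k + 1), ⋂ (_ : i ≠ 0), {x | ‖x i‖ = H i ‖x 0‖} := by
    ext x; simp
  rw [this]
  refine MeasurableSet.iInter fun i => MeasurableSet.iInter fun hi => ?_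
  exact measurableSet_eq_fun (measurable_pi_apply i).norm
    ((hH i hi).comp (measurable_pi_apply 0).norm)

theorem isOrthogonalFrame_snoc {d k : ℕ} {x : Fin k → E d} (hx : IsOrthogonalFrame x) {y : E d}
    (h0 : y ≠ 0) (hy : ∀ i, inner ℝ (x i) y = 0) :
    IsOrthogonalFrame (Fin.snoc x y : Fin (k + 1) → E d) := by
  refine ⟨fun i => ?_, pairwise_orthogonal_snoc hx.2 hy⟩
  refine Fin.lastCases ?_ (fun i => ?_) i
  · simpa using h0
  · simpa using hx.1 i

theorem norm_snoc_eq {d k : ℕ} {H : ℕ → ℝ → ℝ} {x : Fin (k + 1) → E d} {y : E d}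
    (hx : ∀ i : Fin (k + 1), i ≠ 0 → ‖x i‖ = H i ‖x 0‖) (hy : ‖y‖ = H (k + 1) ‖x 0‖) :
    ∀ i : Fin (k + 2), i ≠ 0 → ‖(Fin.snoc x y : Fin (k + 2) → E d) i‖ =
      H i ‖(Fin.snoc x y : Fin (k + 2) → E d) 0‖ := by
  have h0 : (Fin.snoc x y : Fin (k + 2) → E d) 0 = x 0 := by
    rw [← Fin.castSucc_zero, Fin.snoc_castSucc]
  intro i
  rw [h0]
  refine Fin.lastCases ?_ (fun i => ?_) i
  · intro _; simpa using hy
  · intro hi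
    rw [Fin.snoc_castSucc, Fin.val_castSucc]
    exact hx i fun h => hi (by rw [h, Fin.castSucc_zero])

theorem IsRadialFrameLaw.ae_of_ae {d k : ℕ} {μ₁ : Measure (E d)} {H : ℕ → ℝ → ℝ}
    {m : Measure (Fin (k + 1) → E d)} (hm : IsRadialFrameLaw μ₁ H m) {p : E d → Prop}
    (hp : ∀ᵐ x ∂μ₁, p x) : ∀ᵐ x ∂m, p (x 0) := by
  rw [← hm.map_zero] at hp
  exact ae_of_ae_map (measurable_pi_apply 0).aemeasurable hp

/-- The new vector is almost surely nonzero, orthogonal to the others and of the prescribed norm.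
The kernel leaves `x 0` unchanged and commutes with isometries. -/
theorem IsRadialFrameLaw.bind_snocKernel {d k : ℕ} (hk : k + 1 < d) {μ₁ : Measure (E d)}
    {H : ℕ → ℝ → ℝ} {m : Measure (Fin (k + 1) → E d)} (hm : IsRadialFrameLaw μ₁ H m)
    (hH : ∀ i : Fin (k + 2), i ≠ 0 → Measurable (H i)) (hpos : ∀ᵐ x ∂μ₁, 0 < H (k + 1) ‖x‖) :
    IsRadialFrameLaw μ₁ H (m.bind (snocKernel (H (k + 1)))) := by
  have := hm.prob
  have hmeas : Measurable (H (k + 1)) := by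
    simpa using hH (Fin.last (k + 1)) (Fin.last_pos).ne'
  have hpos' := hm.ae_of_ae hpos
  have hκ := aemeasurable_snocKernel hk hmeas hm.ae_frame hpos'
  have hκp : ∀ᵐ x ∂m, IsProbabilityMeasure (uniformOrthSphere x (H (k + 1) ‖x 0‖)) := by
    filter_upwards [hm.ae_frame, hpos'] with x hx hpos
    exact isProbabilityMeasure_uniformOrthSphere hk hx hpos.ne'
  refine ⟨?_, ?_, ?_, ?_, fun R => ?_⟩
  · refine isProbabilityMeasure_bind hκ ?_
    filter_upwards [hκp] with x hx
    exact Measure.isProbabilityMeasure_map (measurable_snoc_right x).aemeasurable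
  · rw [map_bind_eq hκ (measurable_pi_apply 0), ← hm.map_zero,
      ← Measure.bind_dirac_eq_map _ (measurable_pi_apply 0)]
    refine Measure.bind_congr_right ?_
    filter_upwards [hκp] with x hx
    rw [snocKernel, Measure.map_map (measurable_pi_apply 0) (measurable_snoc_right x)]
    have : ((fun z : Fin (k + 2) → E d => z 0) ∘ fun y => Fin.snoc x y) = fun _ => x 0 := by
      ext1 y
      simp only [Function.comp]
      rw [← Fin.castSucc_zero, Fin.snoc_castSucc]
    rw [this, Measure.map_const]
    simp
  · refine ae_bind_of_ae_ae hκ measurableSet_isOrthogonalFrame ?_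
    filter_upwards [hm.ae_frame, hpos'] with x hx hpos
    rw [snocKernel, ae_map_iff (measurable_snoc_right x).aemeasurable measurableSet_isOrthogonalFrame]
    filter_upwards [ae_uniformOrthSphere x (H (k + 1) ‖x 0‖)] with y hy
    refine isOrthogonalFrame_snoc hx ?_ hy.2
    rw [← norm_ne_zero_iff, hy.1]
    exact abs_ne_zero.2 hpos.ne'
  · refine ae_bind_of_ae_ae hκ (measurableSet_norm_eq hH) ?_
    filter_upwards [hm.ae_norm, hpos'] with x hx hpos
    rw [snocKernel, ae_map_iff (measurable_snoc_right x).aemeasurable (measurableSet_norm_eq hH)]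
    filter_upwards [ae_uniformOrthSphere x (H (k + 1) ‖x 0‖)] with y hy
    exact norm_snoc_eq hx (by rw [hy.1, abs_of_pos hpos])
  · have hT : ∀ j, Measurable fun (z : Fin j → E d) i => R (z i) := fun j =>
      measurable_pi_lambda _ fun i => R.continuous.measurable.comp (measurable_pi_apply i)
    rw [map_bind_eq hκ (hT _)]
    simp only [← snocKernel_comp_linearIsometryEquiv]
    rw [← bind_map_eq (hT _), hm.map_isometry R]
    rwa [hm.map_isometry R]

theorem isRadialFrameLaw_sphericalLaw {d : ℕ} {μ₁ : Measure (E d)} [IsProbabilityMeasure μ₁]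
    (hrad : RadiallySymmetric μ₁) (h0 : ∀ᵐ x ∂μ₁, x ≠ 0) {H : ℕ → ℝ → ℝ} (k : ℕ) (hk : k < d)
    (hH : ∀ i : Fin (k + 1), i ≠ 0 → Measurable (H i) ∧ ∀ᵐ x ∂μ₁, 0 < H i ‖x‖) :
    IsRadialFrameLaw μ₁ H (sphericalLaw μ₁ H k) := by
  induction k with
  | zero =>
    have hc : Measurable fun (x : E d) (_ : Fin 1) => x := measurable_pi_lambda _ fun _ => measurable_id
    refine ⟨Measure.isProbabilityMeasure_map hc.aemeasurable, ?_, ?_, ?_, fun R => ?_⟩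
    · rw [sphericalLaw, Measure.map_map (measurable_pi_apply 0) hc]
      exact Measure.map_id
    · rw [sphericalLaw, ae_map_iff hc.aemeasurable measurableSet_isOrthogonalFrame]
      filter_upwards [h0] with x hx
      exact ⟨fun _ => hx, fun i j h => absurd (Subsingleton.elim (α := Fin 1) i j) h⟩
    · exact Filter.Eventually.of_forall fun x i hi => absurd (Subsingleton.elim (α := Fin 1) i 0) hi
    · have hT : Measurable fun (z : Fin 1 → E d) i => R (z i) :=
        measurable_pi_lambda _ fun i => R.continuous.measurable.comp (measurable_pi_apply i)
      rw [sphericalLaw, Measure.map_map hT hc]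
      conv_rhs => rw [← hrad R, Measure.map_map hc R.continuous.measurable]
      rfl
  | succ k ih =>
    rw [sphericalLaw_succ]
    refine (ih (by omega) fun i hi => ?_).bind_snocKernel hk (fun i hi => (hH i hi).1) ?_
    · simpa using hH (Fin.castSucc i) fun h => hi (Fin.castSucc_injective _ h)
    · simpa using (hH (Fin.last (k + 1)) (Fin.last_pos).ne').2

end SphericalLaw

/-! ### The explicit plan and its admissibility -/

section RadialPlan

/-- The completion of a family by a multiple of the wedge product of its normalized vectors. -/
def wedgeCompletion {n : ℕ} (h : ℝ → ℝ) (x : Fin (n + 1) → E (n + 2)) : Fin (n + 2) → E (n + 2) :=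
  Fin.snoc x (h ‖x 0‖ • wedge fun i => ‖x i‖⁻¹ • x i)

theorem measurable_wedgeCompletion {n : ℕ} {h : ℝ → ℝ} (hh : Measurable h) :
    Measurable (wedgeCompletion h : (Fin (n + 1) → E (n + 2)) → Fin (n + 2) → E (n + 2)) := by
  have h1 : Measurable fun x : Fin (n + 1) → E (n + 2) => h ‖x 0‖ • wedge fun i => ‖x i‖⁻¹ • x i :=
    Measurable.smul (hh.comp (measurable_pi_apply 0).norm)
      (measurable_wedge.comp (by fun_prop))
  exact measurable_snoc.comp (measurable_id.prodMk h1)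

theorem radialPlan_eq_map {n : ℕ} (μ₁ : Measure (E (n + 2))) {H : ℕ → ℝ → ℝ}
    (hH : Measurable (H (n + 1))) :
    radialPlan μ₁ H = (sphericalLaw μ₁ H n).map (wedgeCompletion (H (n + 1))) :=
  Measure.bind_dirac_eq_map _ (measurable_wedgeCompletion hH)

theorem wedgeCompletion_zero {n : ℕ} (h : ℝ → ℝ) (x : Fin (n + 1) → E (n + 2)) :
    wedgeCompletion h x 0 = x 0 :=
  Fin.snoc_castSucc (α := fun _ => E (n + 2)) _ x 0

theorem wedgeCompletion_comp_linearIsometryEquiv {n : ℕ} (h : ℝ → ℝ)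
    (R : E (n + 2) ≃ₗᵢ[ℝ] E (n + 2))
    (hR : 0 < LinearMap.det (R.toLinearEquiv : E (n + 2) →ₗ[ℝ] E (n + 2)))
    (x : Fin (n + 1) → E (n + 2)) :
    wedgeCompletion h (fun i => R (x i)) = fun i => R (wedgeCompletion h x i) := by
  rw [wedgeCompletion, wedgeCompletion, snoc_comp, map_smul, ← wedge_comp_linearIsometryEquiv R hR]
  simp

/-- After pulling out the norms, the determinant of the unit vectors and their wedge `w` is `⟨w, w⟩
= 1`. -/
theorem isDirectOrthogonalBasis_wedgeCompletion {n : ℕ} {h : ℝ → ℝ} {x : Fin (n + 1) → E (n + 2)}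
    (hx : IsOrthogonalFrame x) (hpos : 0 < h ‖x 0‖) :
    IsDirectOrthogonalBasis (wedgeCompletion h x) ∧
      ‖wedgeCompletion h x (Fin.last (n + 1))‖ = h ‖x 0‖ := by
  set u : Fin (n + 1) → E (n + 2) := fun i => ‖x i‖⁻¹ • x i with hu
  have hn : ∀ i, ‖x i‖ ≠ 0 := fun i => norm_ne_zero_iff.2 (hx.1 i)
  have hxu : x = fun i => ‖x i‖ • u i := by
    ext1 i
    rw [hu, smul_smul, mul_inv_cancel₀ (hn i), one_smul]
  have hw : ‖wedge u‖ = 1 := norm_wedge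
    (fun i j hij => by simp [hu, inner_smul_left, inner_smul_right, hx.2 i j hij])
    (fun i => by rw [hu, norm_smul, norm_inv, norm_norm, inv_mul_cancel₀ (hn i)])
  have hxw : ∀ i, inner ℝ (x i) (h ‖x 0‖ • wedge u) = 0 := by
    intro i
    rw [congrFun hxu i, inner_smul_left, inner_smul_right, inner_wedge, mul_zero, mul_zero]
  refine ⟨⟨pairwise_orthogonal_snoc hx.2 hxw, ?_⟩, ?_⟩
  · have h1 : wedgeCompletion h x = fun i => (Fin.snoc (fun i => ‖x i‖) (h ‖x 0‖) : Fin (n + 2) → ℝ) i •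
        (Fin.snoc u (wedge u) : Fin (n + 2) → E (n + 2)) i := by
      ext1 i
      refine Fin.lastCases ?_ (fun i => ?_) i
      · simp [wedgeCompletion, hu]
      · simp only [wedgeCompletion, Fin.snoc_castSucc]
        exact congrFun hxu i
    rw [h1, vdet_smul, vdet_snoc_eq_inner_wedge, real_inner_self_eq_norm_sq, hw, one_pow, mul_one,
      Fin.prod_univ_castSucc]
    simp only [Fin.snoc_castSucc, Fin.snoc_last]
    exact mul_pos (Finset.prod_pos fun i _ => norm_pos_iff.2 (hx.1 i)) hpos
  · rw [wedgeCompletion, Fin.snoc_last, norm_smul, hw, mul_one, Real.norm_of_nonneg hpos.le]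

theorem measurableSet_isDirectOrthogonalBasis {d : ℕ} :
    MeasurableSet {x : Fin d → E d | IsDirectOrthogonalBasis x} := by
  have : {x : Fin d → E d | IsDirectOrthogonalBasis x} =
      (⋂ i, ⋂ j, ⋂ (_ : i ≠ j), {x | inner ℝ (x i) (x j) = 0}) ∩ {x | 0 < vdet x} := by
    ext x; simp [IsDirectOrthogonalBasis]
  rw [this]
  refine MeasurableSet.inter
    (MeasurableSet.iInter fun i => MeasurableSet.iInter fun j => MeasurableSet.iInter fun _ => ?_)
    (measurableSet_lt measurable_const measurable_vdet)
  exact measurableSet_eq_fun (by fun_prop) measurable_const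

theorem RadiallySymmetric.charFun_eq {d : ℕ} {μ : Measure (E d)} (hμ : RadiallySymmetric μ)
    (x y : E d) (h : ‖x‖ = ‖y‖) : charFun μ x = charFun μ y := by
  obtain ⟨R, rfl⟩ := exists_linearIsometryEquiv_apply_eq h
  exact (charFun_comp_linearIsometryEquiv R (hμ R) x).symm

theorem ae_radialLaw_pos {d : ℕ} {μ : Measure (E d)} (h0 : radialLaw μ {0} = 0) :
    ∀ᵐ r ∂radialLaw μ, 0 < r := by
  have h1 : ∀ᵐ r ∂radialLaw μ, 0 ≤ r := by
    rw [radialLaw, ae_map_iff (by fun_prop) measurableSet_Ici]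
    exact Filter.Eventually.of_forall fun x => norm_nonneg x
  have h2 : ∀ᵐ r ∂radialLaw μ, r ≠ 0 := by
    rw [ae_iff]
    simpa using h0
  filter_upwards [h1, h2] with r a b using lt_of_le_of_ne a b.symm

/-- Without an atom at `0`, the target radial law lives on positive radii. Hence all spheres in the
construction are nondegenerate. -/
theorem IsMonotoneRearrangement.ae_pos {d : ℕ} {μ ν : Measure (E d)} {h : ℝ → ℝ}
    (hh : IsMonotoneRearrangement (radialLaw μ) (radialLaw ν) h) (h0 : radialLaw ν {0} = 0) :
    ∀ᵐ x ∂μ, 0 < h ‖x‖ := by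
  have h1 := ae_radialLaw_pos h0
  rw [← hh.2.1] at h1
  exact ae_of_ae_map (f := fun x => ‖x‖) (by fun_prop) (ae_of_ae_map hh.1.aemeasurable h1)

theorem radialLaw_map_apply {d k : ℕ} (γ : Measure (Fin k → E d)) (i : Fin k) :
    radialLaw (γ.map fun x => x i) = γ.map fun x => ‖x i‖ :=
  Measure.map_map measurable_norm (measurable_pi_apply i)

variable {n : ℕ} {μ : Fin (n + 2) → Measure (E (n + 2))} {H : ℕ → ℝ → ℝ}

theorem isRadialFrameLaw_sphericalLaw_of_isMonotoneRearrangement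
    (hprob : ∀ i, IsProbabilityMeasure (μ i)) (hrad : ∀ i, RadiallySymmetric (μ i))
    (hatom : ∀ i, radialLaw (μ i) {0} = 0)
    (hH : ∀ i : Fin (n + 2), i ≠ 0 →
      IsMonotoneRearrangement (radialLaw (μ 0)) (radialLaw (μ i)) (H i)) :
    IsRadialFrameLaw (μ 0) H (sphericalLaw (μ 0) H n) := by
  have := hprob 0
  refine isRadialFrameLaw_sphericalLaw (hrad 0) ?_ n (by omega) fun i hi => ?_
  · have h1 := ae_radialLaw_pos (hatom 0)
    rw [radialLaw] at h1
    filter_upwards [ae_of_ae_map (by fun_prop) h1] with x hx using norm_pos_iff.1 hx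
  · have h1 := hH (Fin.castSucc i) fun h => hi (Fin.castSucc_injective _ h)
    exact ⟨h1.1, h1.ae_pos (hatom _)⟩

theorem ae_radialPlan
    (hprob : ∀ i, IsProbabilityMeasure (μ i)) (hrad : ∀ i, RadiallySymmetric (μ i))
    (hatom : ∀ i, radialLaw (μ i) {0} = 0)
    (hH : ∀ i : Fin (n + 2), i ≠ 0 →
      IsMonotoneRearrangement (radialLaw (μ 0)) (radialLaw (μ i)) (H i)) :
    ∀ᵐ x ∂radialPlan (μ 0) H, IsDirectOrthogonalBasis x ∧
        ∀ i : Fin (n + 2), i ≠ 0 → ‖x i‖ = H i ‖x 0‖ := by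
  have hm := isRadialFrameLaw_sphericalLaw_of_isMonotoneRearrangement hprob hrad hatom hH
  have hlast : IsMonotoneRearrangement (radialLaw (μ 0)) (radialLaw (μ (Fin.last (n + 1))))
      (H (n + 1)) := hH (Fin.last (n + 1)) (Fin.last_pos).ne'
  have hms : MeasurableSet {x : Fin (n + 2) → E (n + 2) | IsDirectOrthogonalBasis x ∧
      ∀ i : Fin (n + 2), i ≠ 0 → ‖x i‖ = H i ‖x 0‖} :=
    measurableSet_isDirectOrthogonalBasis.inter (measurableSet_norm_eq fun i hi => (hH i hi).1)
  rw [radialPlan_eq_map _ hlast.1, ae_map_iff (measurable_wedgeCompletion hlast.1).aemeasurable hms]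
  filter_upwards [hm.ae_frame, hm.ae_norm, hm.ae_of_ae (hlast.ae_pos (hatom _))] with x h1 h2 h3
  obtain ⟨h4, h5⟩ := isDirectOrthogonalBasis_wedgeCompletion (h := H (n + 1)) h1 h3
  refine ⟨h4, norm_snoc_eq h2 ?_⟩
  rwa [wedgeCompletion, Fin.snoc_last] at h5

/-- The marginals have the prescribed radial laws, so radial characteristic functions suffice.
Completion by the wedge commutes with rotations only, but these already act transitively on spheres
in dimension at least two. -/
theorem radialPlan_mem_plans
    (hprob : ∀ i, IsProbabilityMeasure (μ i)) (hrad : ∀ i, RadiallySymmetric (μ i))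
    (hatom : ∀ i, radialLaw (μ i) {0} = 0)
    (hH : ∀ i : Fin (n + 2), i ≠ 0 →
      IsMonotoneRearrangement (radialLaw (μ 0)) (radialLaw (μ i)) (H i)) :
    radialPlan (μ 0) H ∈ plans μ := by
  have hm := isRadialFrameLaw_sphericalLaw_of_isMonotoneRearrangement hprob hrad hatom hH
  have hae := ae_radialPlan hprob hrad hatom hH
  have := hm.prob
  have hlast : Measurable (H (n + 1)) := (hH (Fin.last (n + 1)) (Fin.last_pos).ne').1
  have hF := measurable_wedgeCompletion (n := n) hlast
  have hplan := radialPlan_eq_map (μ 0) hlast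
  have hγ : IsProbabilityMeasure (radialPlan (μ 0) H) := by
    rw [hplan]; exact Measure.isProbabilityMeasure_map hF.aemeasurable
  have h0 : (radialPlan (μ 0) H).map (fun x => x 0) = μ 0 := by
    rw [hplan, Measure.map_map (measurable_pi_apply 0) hF]
    conv_rhs => rw [← hm.map_zero]
    exact congrArg (fun f => Measure.map f _) (funext fun x => wedgeCompletion_zero _ x)
  refine ⟨hγ, fun i => ?_⟩
  by_cases hi : i = 0
  · rw [hi, h0]
  have hpi : IsProbabilityMeasure ((radialPlan (μ 0) H).map fun x => x i) :=
    Measure.isProbabilityMeasure_map (measurable_pi_apply i).aemeasurable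
  have := hprob i
  refine measure_eq_of_radialLaw_eq (by omega) (fun x y hxy => ?_) (hrad i).charFun_eq ?_
  · obtain ⟨R, hR, rfl⟩ := exists_rotation_apply_eq hxy
    refine (charFun_comp_linearIsometryEquiv R ?_ x).symm
    have hRm : Measurable R := R.continuous.measurable
    have hT : ∀ j, Measurable fun (z : Fin j → E (n + 2)) i => R (z i) := fun j =>
      measurable_pi_lambda _ fun i => hRm.comp (measurable_pi_apply i)
    have hinv : (radialPlan (μ 0) H).map (fun x i => R (x i)) = radialPlan (μ 0) H := by
      rw [hplan, Measure.map_map (hT _) hF]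
      conv_rhs => rw [← hm.map_isometry R, Measure.map_map hF (hT _)]
      congr 1
      ext1 x
      exact (wedgeCompletion_comp_linearIsometryEquiv _ R hR x).symm
    rw [Measure.map_map hRm (measurable_pi_apply i)]
    conv_rhs => rw [← hinv, Measure.map_map (measurable_pi_apply i) (hT _)]
    rfl
  · rw [← (hH i hi).2.1]
    conv_rhs => rw [← h0]
    rw [radialLaw_map_apply, radialLaw_map_apply,
      Measure.map_map (hH i hi).1 (measurable_pi_apply 0).norm]
    refine Measure.map_congr ?_
    filter_upwards [hae] with x hx using hx.2 i hi

end RadialPlan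

/-! ### Optimality and integrability -/

section Optimality

variable {n : ℕ} {μ : Fin (n + 2) → Measure (E (n + 2))} {H : ℕ → ℝ → ℝ}

/-- Hadamard's inequality followed by the comonotone bound. Both are equalities for the explicit
plan. -/
theorem lintegral_vdet_le
    (hprob : ∀ i, IsProbabilityMeasure (μ i)) (hrad : ∀ i, RadiallySymmetric (μ i))
    (hatom : ∀ i, radialLaw (μ i) {0} = 0)
    (hH : ∀ i : Fin (n + 2), i ≠ 0 →
      IsMonotoneRearrangement (radialLaw (μ 0)) (radialLaw (μ i)) (H i))
    {γ : Measure (Fin (n + 2) → E (n + 2))} (hγ : γ ∈ plans μ) :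
    ∫⁻ x, ENNReal.ofReal (vdet x) ∂γ ≤ ∫⁻ x, ENNReal.ofReal (vdet x) ∂radialPlan (μ 0) H := by
  have := hγ.1
  have := hprob 0
  have hplan := radialPlan_mem_plans hprob hrad hatom hH
  have hρ : IsProbabilityMeasure (radialLaw (μ 0)) := Measure.isProbabilityMeasure_map (by fun_prop)
  -- The norm of the first vector is the common variable, so the identity takes the place of `H 0`,
  -- which is arbitrary.
  set Y : Fin (n + 2) → ℝ → ℝ := fun i => if i = 0 then id else H i with hY
  have hYm : ∀ i, Measurable (Y i) := by
    intro i
    by_cases hi : i = 0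
    · simp only [hY, if_pos hi]; exact measurable_id
    · simp only [hY, if_neg hi]; exact (hH i hi).1
  have hYmap : ∀ i, (radialLaw (μ 0)).map (Y i) = radialLaw (μ i) := by
    intro i
    by_cases hi : i = 0
    · simp only [hY, hi]; exact Measure.map_id
    · simp only [hY, if_neg hi]; exact (hH i hi).2.1
  have hS : ∀ i, ∃ S : Set ℝ, (∀ᵐ t ∂radialLaw (μ 0), t ∈ S) ∧ MonotoneOn (Y i) S := by
    intro i
    by_cases hi : i = 0
    · exact ⟨Set.univ, by simp, by simp only [hY, if_pos hi]; exact monotone_id.monotoneOn _⟩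
    · simp only [hY, if_neg hi]
      exact (hH i hi).2.2
  choose S hSae hSm using hS
  have hXm : ∀ i, Measurable fun x : Fin (n + 2) → E (n + 2) => ‖x i‖ :=
    fun i => (measurable_pi_apply i).norm
  calc ∫⁻ x, ENNReal.ofReal (vdet x) ∂γ ≤ ∫⁻ x, ∏ i, ENNReal.ofReal ‖x i‖ ∂γ := by
        refine lintegral_mono fun x => ?_
        rw [← ENNReal.ofReal_prod_of_nonneg fun i _ => norm_nonneg _]
        exact ENNReal.ofReal_le_ofReal ((le_abs_self _).trans (abs_vdet_le x))
    _ ≤ ∫⁻ r, ∏ i, ENNReal.ofReal (Y i r) ∂radialLaw (μ 0) := by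
        refine lintegral_prod_le_of_monotoneOn γ (fun i x => ‖x i‖) hXm _ Y hYm (fun i => ?_)
          (⋂ i, S i) ?_ fun i => (hSm i).mono (Set.iInter_subset _ i)
        · rw [hYmap, ← hγ.2 i, radialLaw_map_apply]
        · filter_upwards [ae_all_iff.2 hSae] with t ht using Set.mem_iInter.2 ht
    _ = ∫⁻ x, ∏ i, ENNReal.ofReal (Y i ‖x 0‖) ∂radialPlan (μ 0) H := by
        have h0 : radialLaw (μ 0) = (radialPlan (μ 0) H).map fun x => ‖x 0‖ := by
          rw [← radialLaw_map_apply, hplan.2 0]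
        rw [h0, lintegral_map (by fun_prop) (hXm 0)]
    _ = ∫⁻ x, ENNReal.ofReal (vdet x) ∂radialPlan (μ 0) H := by
        refine lintegral_congr_ae ?_
        filter_upwards [ae_radialPlan hprob hrad hatom hH] with x hx
        rw [← abs_of_pos hx.1.2, abs_vdet_of_pairwise_orthogonal hx.1.1,
          ENNReal.ofReal_prod_of_nonneg fun i _ => norm_nonneg _]
        refine Finset.prod_congr rfl fun i _ => ?_
        by_cases hi : i = 0
        · simp [hY, hi]
        · simp only [hY, if_neg hi, hx.2 i hi]

theorem lintegral_neg_vdet_radialPlan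
    (hprob : ∀ i, IsProbabilityMeasure (μ i)) (hrad : ∀ i, RadiallySymmetric (μ i))
    (hatom : ∀ i, radialLaw (μ i) {0} = 0)
    (hH : ∀ i : Fin (n + 2), i ≠ 0 →
      IsMonotoneRearrangement (radialLaw (μ 0)) (radialLaw (μ i)) (H i)) :
    ∫⁻ x, ENNReal.ofReal (-vdet x) ∂radialPlan (μ 0) H = 0 := by
  have hms : Measurable fun x : Fin (n + 2) → E (n + 2) => ENNReal.ofReal (-vdet x) :=
    measurable_vdet.neg.ennreal_ofReal
  rw [lintegral_eq_zero_iff hms]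
  filter_upwards [ae_radialPlan hprob hrad hatom hH] with x hx
  exact ENNReal.ofReal_of_nonpos (by linarith [hx.1.2])

/-- Under the moment condition the determinant is integrable for every plan. -/
theorem MomentCondition.integrable_vdet {d : ℕ} {μ : Fin d → Measure (E d)}
    (h : MomentCondition μ) {γ : Measure (Fin d → E d)} (hγ : γ ∈ plans μ) :
    Integrable vdet γ := by
  obtain ⟨p, hp, hsum, hint⟩ := h
  have hi : ∀ i, Integrable (fun x : Fin d → E d => 1 / p i * ‖x i‖ ^ p i) γ := by
    intro i
    have h1 := hint i
    rw [← hγ.2 i] at h1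
    exact (h1.comp_measurable (measurable_pi_apply i)).const_mul _
  refine (integrable_finsetSum Finset.univ fun i _ => hi i).mono'
    measurable_vdet.aestronglyMeasurable (Filter.Eventually.of_forall fun x => ?_)
  rw [Real.norm_eq_abs]
  refine (abs_vdet_le x).trans ?_
  -- Young's inequality `∏ |x_i| ≤ ∑ |x_i|^{p_i} / p_i`, whose right side has integral fixed by the
  -- marginals.
  have h2 := Real.geom_mean_le_arith_mean_weighted Finset.univ (fun i => 1 / p i)
    (fun i => ‖x i‖ ^ p i) (fun i _ => by have := hp i; positivity) hsum
    (fun i _ => by positivity)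
  refine le_trans (le_of_eq (Finset.prod_congr rfl fun i _ => ?_)) h2
  rw [← Real.rpow_mul (norm_nonneg _), mul_one_div_cancel (by linarith [hp i]), Real.rpow_one]

end Optimality

end DetTransport

end

theorem mainTheorem2 (n : ℕ) (μ : Fin (n + 2) → Measure (DetTransport.E (n + 2)))
    (hprob : ∀ i, IsProbabilityMeasure (μ i))
    (hrad : ∀ i, DetTransport.RadiallySymmetric (μ i))
    (hatom : ∀ i r, DetTransport.radialLaw (μ i) {r} = 0) :
    -- the monotone rearrangements exist and are unique almost everywhere
    (∀ i, ∃ h, DetTransport.IsMonotoneRearrangement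
        (DetTransport.radialLaw (μ 0)) (DetTransport.radialLaw (μ i)) h ∧
      ∀ h', DetTransport.IsMonotoneRearrangement
        (DetTransport.radialLaw (μ 0)) (DetTransport.radialLaw (μ i)) h' →
        h' =ᵐ[DetTransport.radialLaw (μ 0)] h) ∧
    ∀ H : ℕ → ℝ → ℝ,
      (∀ i : Fin (n + 2), i ≠ 0 → DetTransport.IsMonotoneRearrangement
        (DetTransport.radialLaw (μ 0)) (DetTransport.radialLaw (μ i)) (H i)) →
      -- the explicit plan is admissible
      DetTransport.radialPlan (μ 0) H ∈ DetTransport.plans μ ∧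
      -- it maximizes the objective, in the extended real sense
      (∀ γ ∈ DetTransport.plans μ, DetTransport.detIntegral γ ≤
        DetTransport.detIntegral (DetTransport.radialPlan (μ 0) H)) ∧
      -- under the moment condition all the integrals are finite and the maximum is a usual one
      (DetTransport.MomentCondition μ →
        (∀ γ ∈ DetTransport.plans μ, Integrable DetTransport.vdet γ) ∧
        ∀ γ ∈ DetTransport.plans μ, ∫ x, DetTransport.vdet x ∂γ ≤
          ∫ x, DetTransport.vdet x ∂(DetTransport.radialPlan (μ 0) H)) ∧
      -- it is carried by the direct orthogonal bases, with the prescribed norms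
      ∀ᵐ x ∂(DetTransport.radialPlan (μ 0) H), DetTransport.IsDirectOrthogonalBasis x ∧
        ∀ i : Fin (n + 2), i ≠ 0 → ‖x i‖ = H i ‖x 0‖ := by
  have hρ : ∀ i, IsProbabilityMeasure (DetTransport.radialLaw (μ i)) := fun i => by
    have := hprob i
    exact Measure.isProbabilityMeasure_map (by fun_prop)
  have hatom0 : ∀ i, DetTransport.radialLaw (μ i) {0} = 0 := fun i => hatom i 0
  refine ⟨fun i => ?_, fun H hH => ?_⟩
  · obtain ⟨h, hh⟩ := DetTransport.exists_isMonotoneRearrangement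
      (DetTransport.radialLaw (μ 0)) (DetTransport.radialLaw (μ i)) (hatom 0)
    exact ⟨h, hh, fun h' hh' => hh.ae_eq hh'⟩
  · have hplan := DetTransport.radialPlan_mem_plans hprob hrad hatom0 hH
    have hneg := DetTransport.lintegral_neg_vdet_radialPlan hprob hrad hatom0 hH
    have hle := fun γ hγ => DetTransport.lintegral_vdet_le hprob hrad hatom0 hH (γ := γ) hγ
    refine ⟨hplan, fun γ hγ => ?_, fun hmom => ⟨fun γ hγ => hmom.integrable_vdet hγ, fun γ hγ => ?_⟩,
      DetTransport.ae_radialPlan hprob hrad hatom0 hH⟩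
    -- The negative part vanishes for the explicit plan, so `∞ - ∞` cannot occur on the right. For a
    -- competitor, subtracting its negative part only lowers the value.
    · rw [DetTransport.detIntegral, DetTransport.detIntegral, hneg]
      exact EReal.sub_le_sub (EReal.coe_ennreal_le_coe_ennreal_iff.2 (hle γ hγ))
        (EReal.coe_ennreal_le_coe_ennreal_iff.2 bot_le)
    · have hint := hmom.integrable_vdet hplan
      rw [integral_eq_lintegral_pos_part_sub_lintegral_neg_part (hmom.integrable_vdet hγ),
        integral_eq_lintegral_pos_part_sub_lintegral_neg_part hint, hneg, ENNReal.toReal_zero]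
      refine sub_le_sub (ENNReal.toReal_mono ?_ (hle γ hγ)) ENNReal.toReal_nonneg
      exact hint.lintegral_lt_top.ne
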